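/- Let $\mathcal G=(G,\mathcal L)$ be a finite labeled graph with non-empty vertex set $\mathcal V$ and labels in a finite alphabet $\mathcal S$, and let $X_{\mathcal G}\subseteq\mathcal S^{\mathbb Z}$ be the sofic shift of label sequences of bi-infinite paths in $G$. For $s\in\mathcal S$ let $\mathbb A_s$ be the $0$-$1$ matrix indexed by $\mathcal V$ whose $(i,j)$ entry is $1$ if and only if some edge from $i$ to $j$ is labeled $s$, and let $\mathbb A=\sum_{s\in\mathcal S}\mathbb A_s$. Assume that $\mathbb A$ is irreducible (for all $i,j$ there is $m\ge 1$ with $(\mathbb A^m)_{i,j}>0$) and that $\mathcal G$ is minimal right-resolving, i.e. edges with the same initial vertex carry different labels, and no right-resolving labeled graph presenting $X_{\mathcal G}$ has fewer vertices. Let $p\ge 1$ be the period of $\mathbb A$ ($p=1$ is the aperiodic case). The natural measure $\mu_{\mathcal G}$ is the Borel probability measure on $X_{\mathcal G}$ that gives each cylinder $\{x\in X_{\mathcal G}: x_\alpha=w_1,\dots,x_{\alpha+n-1}=w_n\}$, with $\alpha\in\mathbb Z$, $n\ge 1$ and $w=(w_1,\dots,w_n)\in\mathcal S^n$, the mass $$\frac1{\lambda^n}\sum_{i,j\in\mathcal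 V}u_i\,(\mathbb A_{w_1}\cdots\mathbb A_{w_n})_{i,j}\,v_j ,$$ where $\lambda$ is the Perron value of $\mathbb A$ and $u,v$ are positive left and right eigenvectors of $\mathbb A$ for $\lambda$ with $\sum_i u_iv_i=1$. Let $\mathcal P_m=\{x\in X_{\mathcal G}:\sigma^m x=x\}$, where $\sigma$ is the shift. For $k,l\ge 0$ and a word $w$ of length $n\ge1$, let $C^{(p)}_{k,l}(w)$ be the set of words $(x_{-k+1},\dots,x_{n+l})$ obtained by restricting points $x\in\mathcal P_{n+k+l-1}$ with $(x_1,\dots,x_n)=w$ to the sites $-k+1,\dots,n+l$. The periodic natural measure $\mu^{(p)}_{\mathcal G}$ is the Borel probability measure on $X_{\mathcal G}$ that gives each cylinder of $w$, at every initial site $\alpha$, the mass $$\lim_{\substack{k,l\to\infty\\ n+k+l-1\equiv 0\ (\mathrm{mod}\ p)}}\ \frac1p\,\frac{\sum_{j=0}^{p-1}\bigl|C^{(p)}_{k-j,\,l+j}(w)\bigr|}{\bigl|\mathcal P_{n+k+l-1}\bigr|}$$ (for $p=1$ this is $\lim_{k,l\to\infty}|C^{(p)}_{k,l}(w)|/|\mathcal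 P_{n+k+l-1}|$). Then $\mu_{\mathcal G}$ exists and is unique, all the limits above exist, $\mu^{(p)}_{\mathcal G}$ exists and is unique, and $$\mu^{(p)}_{\mathcal G}=\mu_{\mathcal G}.$$ -/

import Mathlib

open MeasureTheory Filter Topology

noncomputable section

/-- A labeled (multi)graph with vertices `V`, edges `E` and labels in the alphabet `S`. -/
structure LabeledGraph (V E S : Type*) where
  /-- initial vertex of an edge -/
  src : E → V
  /-- terminal vertex of an edge -/
  tgt : E → V
  /-- label of an edge -/
  label : E → S

/-- The shift map on two-sided sequences. -/
def shiftMap {S : Type*} (x : ℤ → S) : ℤ → S := fun i => x (i + 1)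

/-- The words of length `m` that occur in some point of `X` (admissible patterns). -/
def admissibleWords {S : Type*} (X : Set (ℤ → S)) (m : ℕ) : Set (Fin m → S) :=
  {u | ∃ x ∈ X, ∃ a : ℤ, ∀ t : Fin m, x (a + (t : ℤ)) = u t}

/-- The points of `X` fixed by the `m`-th power of the shift. -/
def periodicPoints {S : Type*} (X : Set (ℤ → S)) (m : ℕ) : Set (ℤ → S) :=
  {x | x ∈ X ∧ shiftMap^[m] x = x}

/-- The cylinder `{x ∈ X | x_α = w_1, …, x_{α+n-1} = w_n}`. -/
def cylinderAt {S : Type*} (X : Set (ℤ → S)) (α : ℤ) {n : ℕ} (w : Fin n → S) : Set X :=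
  {x | ∀ i : Fin n, x.1 (α + (i : ℤ)) = w i}

/-- The finite cylinder of admissible words `(x_{-k+1}, …, x_{n+l})` of length `n + k + l`
with `(x_1, …, x_n) = w`; the entry `u t` is the symbol at the site `t - k + 1`. -/
def finiteCylinder {S : Type*} (X : Set (ℤ → S)) (k l : ℕ) {n : ℕ} (w : Fin n → S) :
    Set (Fin (n + k + l) → S) :=
  {u | u ∈ admissibleWords X (n + k + l) ∧
    ∀ i : Fin n, u ⟨k + i, by have := i.isLt; omega⟩ = w i}

/-- The words of the finite cylinder that are the restriction to the sites `-k+1, …, n+l` of a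
point of `X` with period `n + k + l - 1`. -/
def periodicFiniteCylinder {S : Type*} (X : Set (ℤ → S)) (k l : ℕ) {n : ℕ} (w : Fin n → S) :
    Set (Fin (n + k + l) → S) :=
  {u | u ∈ finiteCylinder X k l w ∧
    ∃ x ∈ periodicPoints X (n + k + l - 1),
      ∀ t : Fin (n + k + l), x ((t : ℤ) - (k : ℤ) + 1) = u t}

/-- `r` is the Perron value of the real square matrix `A`: a non-negative eigenvalue that
dominates the absolute values of all complex eigenvalues. -/
def IsPerronValue {V : Type*} [Fintype V] [DecidableEq V] (A : Matrix V V ℝ) (r : ℝ) : Prop :=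
  0 ≤ r ∧ Module.End.HasEigenvalue (Matrix.toLin' A) r ∧
    ∀ z : ℂ, Module.End.HasEigenvalue (Matrix.toLin' (A.map (fun a : ℝ => (a : ℂ)))) z → ‖z‖ ≤ r

/-- The period of a non-negative square matrix: the greatest common divisor of all `m ≥ 1` such
that `A ^ m` has a positive diagonal entry. If `A` is irreducible, it is the common value of
`gcd {m ≥ 1 | (A ^ m) i i > 0}` over all indices `i`. -/
def matrixPeriod {V : Type*} [Fintype V] [DecidableEq V] (A : Matrix V V ℝ) : ℕ :=
  Nat.setGcd {m : ℕ | 0 < m ∧ ∃ i, 0 < (A ^ m) i i}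

namespace LabeledGraph

variable {V E S : Type*}

/-- The edge shift: bi-infinite paths. -/
def edgeShift (G : LabeledGraph V E S) : Set (ℤ → E) :=
  {ξ | ∀ i : ℤ, G.tgt (ξ i) = G.src (ξ (i + 1))}

/-- The sofic shift presented by `G`: label sequences of bi-infinite paths. -/
def soficShift (G : LabeledGraph V E S) : Set (ℤ → S) :=
  {x | ∃ ξ ∈ G.edgeShift, ∀ i : ℤ, x i = G.label (ξ i)}

/-- Edges that start at the same vertex carry different labels. -/
def RightResolving (G : LabeledGraph V E S) : Prop :=
  ∀ e f : E, G.src e = G.src f → G.label e = G.label f → e = f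

/-- `G` is right-resolving and has the fewest vertices among all (finite) right-resolving
presentations of its sofic shift. -/
def IsMinimalRightResolving [Fintype V] (G : LabeledGraph V E S) : Prop :=
  G.RightResolving ∧
    ∀ (m e : ℕ) (H : LabeledGraph (Fin m) (Fin e) S),
      H.RightResolving → H.soficShift = G.soficShift → Fintype.card V ≤ m

open Classical in
/-- The adjacency matrix of the symbol `s`: the `(i, j)` entry is `1` if some edge from `i` to `j`
has label `s`, and `0` otherwise. -/
def symbolAdj (G : LabeledGraph V E S) (s : S) : Matrix V V ℝ :=
  Matrix.of fun i j => if ∃ e, G.src e = i ∧ G.tgt e = j ∧ G.label e = s then 1 else 0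

/-- The adjacency matrix of `G`. -/
def adj [Fintype S] (G : LabeledGraph V E S) : Matrix V V ℝ := ∑ s, G.symbolAdj s

/-- The product of the symbol adjacency matrices along a word. -/
def wordAdj [Fintype V] [DecidableEq V] (G : LabeledGraph V E S) {n : ℕ} (w : Fin n → S) :
    Matrix V V ℝ :=
  (List.ofFn fun i => G.symbolAdj (w i)).prod

variable [Fintype V] [DecidableEq V] [Fintype S] [MeasurableSpace S]

/-- The natural measure of `G`: the probability measure on the sofic shift that gives every
cylinder of a word `w` of length `n ≥ 1` the mass `r⁻ⁿ ∑ᵢⱼ uᵢ (A_{w_1} ⋯ A_{w_n})ᵢⱼ vⱼ`, where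
`r` is the Perron value of the adjacency matrix and `u`, `v` are its positive left and right
eigenvectors with `∑ᵢ uᵢ vᵢ = 1`. -/
def IsNaturalMeasure (G : LabeledGraph V E S) (μ : Measure G.soficShift) : Prop :=
  IsProbabilityMeasure μ ∧
    ∃ (r : ℝ) (u v : V → ℝ), IsPerronValue G.adj r ∧
      (∀ i, 0 < u i) ∧ (∀ i, 0 < v i) ∧
      Matrix.vecMul u G.adj = r • u ∧ Matrix.mulVec G.adj v = r • v ∧ ∑ i, u i * v i = 1 ∧
      ∀ (α : ℤ) (n : ℕ) (w : Fin n → S), 0 < n →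
        μ.real (cylinderAt G.soficShift α w) = (1 / r ^ n) * ∑ i, ∑ j, u i * G.wordAdj w i j * v j

/-- The ratio `(1/p) (∑_{j<p} |C^{(p)}_{k-j,l+j}(w)|) / |P_{n+k+l-1}|`, where `p` is the period of
the adjacency matrix (only large `k` matter, so the truncated subtraction `k - j` is harmless).
If `p = 1`, this is `|C^{(p)}_{k,l}(w)| / |P_{n+k+l-1}|`. -/
def periodicRatio (G : LabeledGraph V E S) {n : ℕ} (w : Fin n → S) (k l : ℕ) : ℝ :=
  (1 / (matrixPeriod G.adj : ℝ)) *
    ((∑ j ∈ Finset.range (matrixPeriod G.adj),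
        ((periodicFiniteCylinder G.soficShift (k - j) (l + j) w).ncard : ℝ)) /
      ((periodicPoints G.soficShift (n + k + l - 1)).ncard : ℝ))

/-- The periodic natural measure of `G`: the probability measure on the sofic shift whose value on
every cylinder of a word `w` of length `n ≥ 1` is the limit of the ratios above as `k, l → ∞`
independently, subject to `n + k + l - 1 ≡ 0` modulo the period (no constraint if the period
is `1`). -/
def IsPeriodicNaturalMeasure (G : LabeledGraph V E S) (μ : Measure G.soficShift) : Prop :=
  IsProbabilityMeasure μ ∧
    ∀ (α : ℤ) (n : ℕ) (w : Fin n → S), 0 < n →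
      Tendsto (fun q : ℕ × ℕ => G.periodicRatio w q.1 q.2)
        ((atTop ×ˢ atTop) ⊓ 𝓟 {q : ℕ × ℕ | matrixPeriod G.adj ∣ n + q.1 + q.2 - 1})
        (𝓝 (μ.real (cylinderAt G.soficShift α w)))

end LabeledGraph

end

/-! Write `A` for the adjacency matrix, `A_w` for the product along a word `w` of length `n`, `p`
for the period and `r` for the Perron value. Both measures arise as the limit of the uniform
measures on the `N`-periodic points, with `N` running through the multiples of `p`.

Perron–Frobenius theory gives `(A ^ m) j i / r ^ m → p * v j * u i` along the `m` allowed by the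
cyclic classes (`Matrix.IsIrreducible.tendsto_pow_div`). Hence `tr(A_w A^(N-n)) / r^N` tends to `p`
times the natural mass of `w`. This trace counts loops of length `N` whose label begins with `w`,
whereas the periodic measure counts periodic label sequences.

The two counts agree up to `o(r^N)`. Minimality forces distinct vertices to have distinct follower
sets, and then some word `l` synchronizes: all paths labeled `l` end at the same vertex
(`RightResolving.exists_synchronizing_word`). A period block containing `l` labels exactly one loop
if its periodic extension lies in the shift, and none otherwise (`abs_indicator_sub_trace_le`). The
blocks avoiding `l` contribute at most the number of paths avoiding `l`, which is negligible against
`r^N` by `tendsto_avoidingAdj_mulVec_div`. Dividing by the same asymptotics for the empty word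
cancels `p * r^N` and gives `tendsto_ncard_periodicCylinder_ratio`.

The sets `C_{k-j,l+j}(w)` all have as many elements as there are periodic points in the cylinder of
`w`, so the average over `j` is an average of equal terms. Existence of the measure follows from
compactness, as cylinders are clopen and their masses pass to cluster points. Uniqueness holds
because cylinder masses determine a probability measure. -/

namespace Matrix

/-! ### Perron–Frobenius eigenvectors of irreducible matrices -/

variable {V : Type*} [Fintype V] [DecidableEq V]

theorem pow_mulVec_of_mulVec_eq_smul {A : Matrix V V ℝ} {r : ℝ} {v : V → ℝ}
    (hv : A *ᵥ v = r • v) (k : ℕ) : A ^ k *ᵥ v = r ^ k • v := by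
  induction k with
  | zero => simp
  | succ k ih => rw [pow_succ, ← mulVec_mulVec, hv, mulVec_smul, ih, smul_smul, pow_succ']

theorem IsIrreducible.exists_pow_pos {A : Matrix V V ℝ} (h : A.IsIrreducible) (i j : V) :
    ∃ k > 0, 0 < (A ^ k) i j :=
  (isIrreducible_iff_exists_pow_pos h.nonneg).1 h i j

theorem pow_add_apply_pos {A : Matrix V V ℝ} (hA : ∀ i j, 0 ≤ A i j) {a b : ℕ} {i j k : V}
    (h₁ : 0 < (A ^ a) i j) (h₂ : 0 < (A ^ b) j k) : 0 < (A ^ (a + b)) i k := by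
  rw [pow_add, mul_apply]
  refine Finset.sum_pos' (fun x _ => mul_nonneg (pow_apply_nonneg hA _ _ _)
    (pow_apply_nonneg hA _ _ _)) ⟨j, Finset.mem_univ _, mul_pos h₁ h₂⟩

theorem IsIrreducible.eigenvalue_pos [Nonempty V] {A : Matrix V V ℝ} (h : A.IsIrreducible)
    {r : ℝ} (hr : 0 ≤ r) {v : V → ℝ} (hv : ∀ i, 0 < v i) (hAv : A *ᵥ v = r • v) : 0 < r := by
  refine lt_of_le_of_ne hr ?_
  rintro rfl
  obtain ⟨i⟩ := ‹Nonempty V›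
  obtain ⟨k, hk0, hk⟩ := h.exists_pow_pos i i
  have h1 := congrFun (pow_mulVec_of_mulVec_eq_smul hAv k) i
  rw [zero_pow hk0.ne', zero_smul] at h1
  have h2 : 0 < (A ^ k *ᵥ v) i := Finset.sum_pos'
    (fun j _ => mul_nonneg (pow_apply_nonneg h.nonneg _ _ _) (hv j).le)
    ⟨i, Finset.mem_univ _, mul_pos hk (hv i)⟩
  exact h2.ne' h1

theorem mulVec_pos {V : Type*} [Fintype V] {B : Matrix V V ℝ} (hB : ∀ i j, 0 < B i j)
    {x : V → ℝ} (hx : ∀ i, 0 ≤ x i) (hx0 : x ≠ 0) (i : V) : 0 < (B *ᵥ x) i := by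
  obtain ⟨j, hj⟩ := Function.ne_iff.1 hx0
  exact Finset.sum_pos' (fun k _ => mul_nonneg (hB i k).le (hx k))
    ⟨j, Finset.mem_univ _, mul_pos (hB i j) (lt_of_le_of_ne (hx j) (Ne.symm hj))⟩

/-- The eigenvector is found by maximising the Collatz–Wielandt bound `t` in `t • x ≤ A *ᵥ x`
over the simplex. -/
theorem IsIrreducible.exists_pos_eigenvector [Nonempty V] {A : Matrix V V ℝ}
    (h : A.IsIrreducible) :
    ∃ (r : ℝ) (v : V → ℝ), 0 < r ∧ (∀ i, 0 < v i) ∧ A *ᵥ v = r • v := by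
  choose k hk0 hk using h.exists_pow_pos
  -- A sum of powers of `A` that is entrywise positive and commutes with `A`: it turns weak
  -- inequalities between vectors into strict ones.
  set B : Matrix V V ℝ := ∑ i, ∑ j, A ^ k i j with hBdef
  have hB : ∀ i j, 0 < B i j := by
    intro i j
    simp only [hBdef, Matrix.sum_apply]
    refine Finset.sum_pos' (fun a _ => Finset.sum_nonneg fun b _ => pow_apply_nonneg h.nonneg _ _ _)
      ⟨i, Finset.mem_univ _, ?_⟩
    exact Finset.sum_pos' (fun b _ => pow_apply_nonneg h.nonneg _ _ _)
      ⟨j, Finset.mem_univ _, hk i j⟩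
  have hAB : A * B = B * A := by
    simp only [hBdef, Finset.mul_sum, Finset.sum_mul, ← pow_succ, ← pow_succ']
  let T : Set (ℝ × (V → ℝ)) :=
    {q | q.2 ∈ stdSimplex ℝ V ∧ 0 ≤ q.1 ∧ ∀ i, q.1 * q.2 i ≤ (A *ᵥ q.2) i}
  have hT : IsCompact T := by
    refine IsCompact.of_isClosed_subset
      ((isCompact_Icc (a := (0 : ℝ)) (b := ∑ i, ∑ j, A i j)).prod (isCompact_stdSimplex ℝ V)) ?_ ?_
    · have h1 : IsClosed {q : ℝ × (V → ℝ) | q.2 ∈ stdSimplex ℝ V} :=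
        (isClosed_stdSimplex ℝ V).preimage continuous_snd
      have h2 : IsClosed {q : ℝ × (V → ℝ) | 0 ≤ q.1} :=
        isClosed_le continuous_const continuous_fst
      have h3 : IsClosed {q : ℝ × (V → ℝ) | ∀ i, q.1 * q.2 i ≤ (A *ᵥ q.2) i} := by
        simp only [Set.ofPred_forall]
        refine isClosed_iInter fun i => isClosed_le (by fun_prop) ?_
        simp only [mulVec, dotProduct]
        fun_prop
      exact h1.inter (h2.inter h3)
    · rintro ⟨t, x⟩ ⟨hx, ht, hle⟩
      refine ⟨⟨ht, ?_⟩, hx⟩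
      calc t = ∑ i, t * x i := by rw [← Finset.mul_sum, hx.2, mul_one]
        _ ≤ ∑ i, (A *ᵥ x) i := Finset.sum_le_sum fun i _ => hle i
        _ ≤ ∑ i, ∑ j, A i j := Finset.sum_le_sum fun i _ => Finset.sum_le_sum fun j _ =>
            mul_le_of_le_one_right (h.nonneg i j)
              (hx.2 ▸ Finset.single_le_sum (fun a _ => hx.1 a) (Finset.mem_univ j))
  have hTne : T.Nonempty := by
    obtain ⟨i₀⟩ := ‹Nonempty V›
    refine ⟨(0, Pi.single i₀ 1), single_mem_stdSimplex ℝ i₀, le_rfl, fun i => ?_⟩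
    simp [h.nonneg]
  obtain ⟨⟨r, x⟩, ⟨hx, hr, hle⟩, hmax⟩ := hT.exists_isMaxOn hTne continuous_fst.continuousOn
  simp only at hx hr hle
  have hx0 : x ≠ 0 := by
    rintro rfl
    have := hx.2
    simp at this
  have hBx := mulVec_pos hB hx.1 hx0
  have heig : A *ᵥ x = r • x := by
    -- If `A x ≥ r x` is not an equality, applying `B` makes it strict in every coordinate, so the
    -- normalized `B x` admits the larger bound `r + δ`.
    by_contra hne
    have hz0 : A *ᵥ x - r • x ≠ 0 := sub_ne_zero.2 hne
    have hz : ∀ i, 0 ≤ (A *ᵥ x - r • x) i := fun i => by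
      simpa using hle i
    have hBz := mulVec_pos hB hz hz0
    have hBz' : ∀ i, (B *ᵥ (A *ᵥ x - r • x)) i = (A *ᵥ (B *ᵥ x)) i - r * (B *ᵥ x) i := by
      intro i
      rw [mulVec_sub, mulVec_mulVec, ← hAB, ← mulVec_mulVec, mulVec_smul]
      simp
    obtain ⟨i₀, hi₀⟩ := Finite.exists_min fun i => (B *ᵥ (A *ᵥ x - r • x)) i / (B *ᵥ x) i
    set δ := (B *ᵥ (A *ᵥ x - r • x)) i₀ / (B *ᵥ x) i₀ with hδ
    have hδ0 : 0 < δ := div_pos (hBz _) (hBx _)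
    set c := ∑ i, (B *ᵥ x) i with hc
    have hc0 : 0 < c := Finset.sum_pos (fun i _ => hBx i) Finset.univ_nonempty
    have hmem : ((r + δ, c⁻¹ • (B *ᵥ x)) : ℝ × (V → ℝ)) ∈ T := by
      refine ⟨⟨fun i => ?_, ?_⟩, by positivity, fun i => ?_⟩
      · simp only [Pi.smul_apply, smul_eq_mul]
        exact mul_nonneg (inv_nonneg.2 hc0.le) (hBx i).le
      · simp only [Pi.smul_apply, smul_eq_mul, ← Finset.mul_sum]
        exact inv_mul_cancel₀ hc0.ne'
      · have h1 := (le_div_iff₀ (hBx i)).1 (hi₀ i)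
        rw [hBz'] at h1
        simp only [mulVec_smul, Pi.smul_apply, smul_eq_mul]
        have h2 := mul_le_mul_of_nonneg_left h1 (inv_nonneg.2 hc0.le)
        nlinarith
    have := hmax hmem
    simp only [Set.mem_ofPred_eq] at this
    linarith
  have hxpos : ∀ i, 0 < x i := by
    intro i
    -- Since `x` is an eigenvector of every power of `A`, `(B x) i` is a multiple of `x i`.
    refine lt_of_le_of_ne (hx.1 i) fun h0 => (hBx i).ne' ?_
    simp only [hBdef, sum_mulVec, pow_mulVec_of_mulVec_eq_smul heig, Finset.sum_apply,
      Pi.smul_apply, ← h0, smul_zero, Finset.sum_const_zero]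
  exact ⟨r, x, h.eigenvalue_pos hr hxpos heig, hxpos, heig⟩

/-- A non-negative matrix with a positive right eigenvector has that eigenvalue as Perron value. -/
theorem isPerronValue_of_pos_eigenvector [Nonempty V] {A : Matrix V V ℝ} (hA : ∀ i j, 0 ≤ A i j)
    {r : ℝ} {v : V → ℝ} (hr : 0 ≤ r) (hv : ∀ i, 0 < v i) (hAv : A *ᵥ v = r • v) :
    IsPerronValue A r := by
  refine ⟨hr, ?_, fun z hz => ?_⟩
  · refine Module.End.hasEigenvalue_of_hasEigenvector (x := v) ⟨?_, ?_⟩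
    · rw [Module.End.mem_eigenspace_iff, toLin'_apply, hAv]
    · rintro rfl
      obtain ⟨i⟩ := ‹Nonempty V›
      simpa using hv i
  · obtain ⟨x, hx, hx0⟩ := hz.exists_hasEigenvector
    rw [Module.End.mem_eigenspace_iff, toLin'_apply] at hx
    -- The least `c` with `|x| ≤ c v` is attained at `i₀`; the triangle inequality in row `i₀` of `A
    -- x = z x` then gives `|z| ≤ r`.
    obtain ⟨i₀, hi₀⟩ := Finite.exists_max fun i => ‖x i‖ / v i
    set c := ‖x i₀‖ / v i₀ with hc
    have hxc : ∀ i, ‖x i‖ ≤ c * v i := fun i => (div_le_iff₀ (hv i)).1 (hi₀ i)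
    have hxi : ‖x i₀‖ = c * v i₀ := by rw [hc, div_mul_cancel₀ _ (hv i₀).ne']
    have hc0 : 0 < c := by
      obtain ⟨j, hj⟩ := Function.ne_iff.1 hx0
      exact lt_of_lt_of_le (div_pos (norm_pos_iff.2 hj) (hv j)) (hi₀ j)
    have h1 : ‖z‖ * ‖x i₀‖ ≤ c * (r * v i₀) := by
      have h2 := congrFun hx i₀
      have h3 := congrFun hAv i₀
      simp only [mulVec, dotProduct, Pi.smul_apply, smul_eq_mul, map_apply] at h2 h3
      rw [← norm_mul, ← h2, ← h3, Finset.mul_sum]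
      refine (norm_sum_le _ _).trans (Finset.sum_le_sum fun j _ => ?_)
      rw [norm_mul, Complex.norm_real, Real.norm_of_nonneg (hA _ _)]
      nlinarith [mul_le_mul_of_nonneg_left (hxc j) (hA i₀ j)]
    rw [hxi] at h1
    have h4 : 0 < c * v i₀ := mul_pos hc0 (hv i₀)
    refine le_of_mul_le_mul_right ?_ h4
    linarith

/-- The left eigenvector comes from the transpose. Evaluating `u ⬝ A v` in two ways shows that both
eigenvalues agree. -/
theorem IsIrreducible.exists_perron_data [Nonempty V] {A : Matrix V V ℝ} (h : A.IsIrreducible) :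
    ∃ (r : ℝ) (u v : V → ℝ), IsPerronValue A r ∧ (∀ i, 0 < u i) ∧ (∀ i, 0 < v i) ∧
      u ᵥ* A = r • u ∧ A *ᵥ v = r • v ∧ ∑ i, u i * v i = 1 := by
  obtain ⟨r, v, hr, hv, hAv⟩ := h.exists_pos_eigenvector
  obtain ⟨r', u, hr', hu, hAu⟩ := h.transpose.exists_pos_eigenvector
  rw [mulVec_transpose] at hAu
  have hs : 0 < u ⬝ᵥ v := Finset.sum_pos (fun i _ => mul_pos (hu i) (hv i)) Finset.univ_nonempty
  have hrr : r' = r := by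
    have h1 := dotProduct_mulVec u A v
    rw [hAu, hAv, dotProduct_smul, smul_dotProduct, smul_eq_mul, smul_eq_mul] at h1
    exact (mul_right_cancel₀ hs.ne' h1).symm
  subst hrr
  refine ⟨r', (u ⬝ᵥ v)⁻¹ • u, v, isPerronValue_of_pos_eigenvector h.nonneg hr.le hv hAv,
    fun i => mul_pos (inv_pos.2 hs) (hu i), hv, ?_, hAv, ?_⟩
  · rw [smul_vecMul, hAu, smul_comm]
  · simp only [Pi.smul_apply, smul_eq_mul, mul_assoc, ← Finset.mul_sum]
    exact inv_mul_cancel₀ hs.ne'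

end Matrix

/-! ### Period, cyclic classes and convergence of powers -/

theorem tendsto_zero_of_antitone_of_contraction {a : ℕ → ℝ} (ha : Antitone a)
    (h0 : ∀ m, 0 ≤ a m) {K : ℕ} {θ : ℝ} (hθ : θ < 1) (hK : ∀ m, a (m + K) ≤ θ * a m) :
    Tendsto a atTop (𝓝 0) := by
  have hbdd : BddBelow (Set.range a) := ⟨0, by rintro _ ⟨m, rfl⟩; exact h0 m⟩
  have hlim := tendsto_atTop_ciInf ha hbdd
  set L := ⨅ m, a m
  have hL0 : 0 ≤ L := ge_of_tendsto' hlim h0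
  have hL : L ≤ θ * L :=
    le_of_tendsto_of_tendsto' (hlim.comp (tendsto_add_atTop_nat K)) (hlim.const_mul θ) hK
  have : L = 0 := by nlinarith
  rwa [this] at hlim

namespace Matrix

variable {V : Type*} [Fintype V] [DecidableEq V]

theorem matrixPeriod_dvd {A : Matrix V V ℝ} {m : ℕ} {i : V} (hi : 0 < (A ^ m) i i) :
    matrixPeriod A ∣ m := by
  rcases Nat.eq_zero_or_pos m with rfl | hm
  · exact dvd_zero _
  · exact Nat.setGcd_dvd_of_mem ⟨hm, i, hi⟩

theorem IsIrreducible.matrixPeriod_pos [Nonempty V] {A : Matrix V V ℝ} (h : A.IsIrreducible) :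
    0 < matrixPeriod A := by
  obtain ⟨i⟩ := ‹Nonempty V›
  obtain ⟨k, hk0, hk⟩ := h.exists_pow_pos i i
  exact Nat.pos_of_dvd_of_pos (matrixPeriod_dvd hk) hk0

/-- The cyclic classes of an irreducible matrix: all entries of high powers that are allowed by
the classes are positive. -/
theorem IsIrreducible.exists_cyclic_classes [Nonempty V] {A : Matrix V V ℝ}
    (h : A.IsIrreducible) :
    ∃ d : V → ZMod (matrixPeriod A), (∀ (m : ℕ) i j, 0 < (A ^ m) i j → d j = d i + m) ∧
      ∃ K : ℕ, ∀ k ≥ K, ∀ i j, d j = d i + k → 0 < (A ^ k) i j := by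
  obtain ⟨i₀⟩ := ‹Nonempty V›
  choose a ha0 ha using h.exists_pow_pos i₀
  choose b hb0 hb using fun i => h.exists_pow_pos i i₀
  -- The class of `i` is the length `a i` of a path from `i₀`, modulo the period. The loops `i₀ → j
  -- → i₀` and `i₀ → i → j → i₀` have lengths divisible by the period; subtract them.
  have hd : ∀ (m : ℕ) i j, 0 < (A ^ m) i j →
      ((a j : ℕ) : ZMod (matrixPeriod A)) = (a i : ZMod (matrixPeriod A)) + m := by
    intro m i j hij
    have h1 := matrixPeriod_dvd (pow_add_apply_pos h.nonneg (ha j) (hb j))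
    have h2 := matrixPeriod_dvd (pow_add_apply_pos h.nonneg
      (pow_add_apply_pos h.nonneg (ha i) hij) (hb j))
    rw [← ZMod.natCast_eq_zero_iff] at h1 h2
    push_cast at h1 h2
    linear_combination h1 - h2
  refine ⟨fun i => a i, hd, ?_⟩
  let R : Set ℕ := {m | 0 < m ∧ 0 < (A ^ m) i₀ i₀}
  -- A loop at `j` can be inserted into a loop `i₀ → j → i₀`, so its length is a difference of two
  -- return times to `i₀`.
  have hR : Nat.setGcd R ∣ matrixPeriod A := by
    refine Nat.dvd_setGcd_iff.2 ?_
    rintro m ⟨hm, j, hj⟩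
    have h1 : a j + b j ∈ R := ⟨by have := ha0 j; omega, pow_add_apply_pos h.nonneg (ha j) (hb j)⟩
    have h2 : a j + m + b j ∈ R := ⟨by omega,
      pow_add_apply_pos h.nonneg (pow_add_apply_pos h.nonneg (ha j) hj) (hb j)⟩
    have h3 := Nat.dvd_sub (Nat.setGcd_dvd_of_mem h2) (Nat.setGcd_dvd_of_mem h1)
    rwa [show a j + m + b j - (a j + b j) = m by omega] at h3
  -- All large multiples of the gcd of the return times are sums of return times.
  obtain ⟨n₀, hn₀⟩ := Nat.exists_mem_closure_of_ge R
  have hret : ∀ m ≥ n₀, matrixPeriod A ∣ m → 0 < (A ^ m) i₀ i₀ := by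
    intro m hm hdvd
    have hmem := hn₀ m hm (hR.trans hdvd)
    clear hm hdvd
    induction hmem using AddSubmonoid.closure_induction with
    | mem x hx => exact hx.2
    | zero => simp
    | add x y _ _ hx hy => exact pow_add_apply_pos h.nonneg hx hy
  -- The route is `i → i₀ → i₀ → j`; this bound leaves at least `n₀` steps for the loop at `i₀`.
  refine ⟨n₀ + ∑ i, b i + ∑ i, a i, fun k hk i j hij => ?_⟩
  have hbi : b i ≤ ∑ i, b i := Finset.single_le_sum (fun _ _ => Nat.zero_le _) (Finset.mem_univ i)
  have haj : a j ≤ ∑ i, a i := Finset.single_le_sum (fun _ _ => Nat.zero_le _) (Finset.mem_univ j)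
  obtain ⟨m, rfl⟩ : ∃ m, k = b i + m + a j := ⟨k - b i - a j, by omega⟩
  refine pow_add_apply_pos h.nonneg (pow_add_apply_pos h.nonneg (hb i) (hret m (by omega) ?_))
    (ha j)
  have h1 := hd _ _ _ (hb i)
  have h2 := hd _ _ _ (ha j)
  rw [← ZMod.natCast_eq_zero_iff]
  push_cast at hij h1 h2
  linear_combination -hij + h1 + h2

section Stochastic

variable {P : Matrix V V ℝ} {π : V → ℝ} {p : ℕ} {d : V → ZMod p}

theorem pow_apply_sum_eq_one (hsum : ∀ i, ∑ j, P i j = 1) (k : ℕ) (i : V) :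
    ∑ j, (P ^ k) i j = 1 := by
  have h1 : P *ᵥ (fun _ => 1) = (1 : ℝ) • (fun _ => (1 : ℝ)) := by
    ext i; simp [mulVec, dotProduct, hsum]
  simpa [mulVec, dotProduct] using congrFun (pow_mulVec_of_mulVec_eq_smul h1 k) i

theorem sum_stationary_mul {V : Type*} [Fintype V] {P : Matrix V V ℝ} {π : V → ℝ}
    (hπP : π ᵥ* P = π) (f : V → ℝ) :
    ∑ i, π i * (P *ᵥ f) i = ∑ i, π i * f i := by
  have := dotProduct_mulVec π P f
  rwa [hπP] at this

/-- One step of `P` carries class `c` exactly into class `c + 1`, so by stationarity consecutive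
classes have equal mass. -/
theorem sum_cyclic_class {V : Type*} [Fintype V] {P : Matrix V V ℝ} {π : V → ℝ}
    {d : V → ZMod p} [NeZero p] (hP : ∀ i j, 0 ≤ P i j) (hsum : ∀ i, ∑ j, P i j = 1)
    (hπP : π ᵥ* P = π) (hπ1 : ∑ i, π i = 1) (hd : ∀ i j, 0 < P i j → d j = d i + 1)
    (c : ZMod p) : ∑ j, (if d j = c then π j else 0) = 1 / p := by
  set F : ZMod p → ℝ := fun c => ∑ j, (if d j = c then π j else 0) with hF
  have hstep : ∀ c, F (c + 1) = F c := by
    intro c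
    have h1 := sum_stationary_mul hπP (fun j => if d j = c + 1 then 1 else 0)
    have h2 : ∀ i, (P *ᵥ fun j => if d j = c + 1 then (1 : ℝ) else 0) i =
        if d i = c then 1 else 0 := by
      intro i
      have h3 : ∀ j, P i j * (if d j = c + 1 then (1 : ℝ) else 0) =
          P i j * (if d i = c then 1 else 0) := by
        intro j
        rcases (hP i j).eq_or_lt with h0 | h0
        · simp [← h0]
        · simp [hd i j h0]
      simp only [mulVec, dotProduct, h3, ← Finset.sum_mul, hsum, one_mul]
    simp only [h2, mul_ite, mul_one, mul_zero] at h1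
    exact h1.symm
  have hconst : ∀ n : ℕ, F n = F 0 := by
    intro n
    induction n with
    | zero => simp
    | succ n ih => rw [Nat.cast_succ, hstep, ih]
  have hconst' : ∀ c, F c = F 0 := fun c => by
    rw [← ZMod.natCast_zmod_val c]; exact hconst _
  have htot : ∑ c, F c = 1 := by
    simp only [hF]
    rw [Finset.sum_comm]
    simpa using hπ1
  have hp : (p : ℝ) ≠ 0 := Nat.cast_ne_zero.2 (NeZero.ne p)
  simp only [hconst', Finset.sum_const, Finset.card_univ, ZMod.card, nsmul_eq_mul] at htot
  change F c = _
  rw [hconst' c, eq_div_iff hp, mul_comm, htot]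

/-- Convergence of the powers of an irreducible stochastic matrix along its cyclic classes, by
Doeblin's contraction argument. -/
theorem tendsto_norm_stochastic_pow_sub [NeZero p] (hP : ∀ i j, 0 ≤ P i j)
    (hsum : ∀ i, ∑ j, P i j = 1) (hπ : ∀ i, 0 < π i) (hπP : π ᵥ* P = π) (hπ1 : ∑ i, π i = 1)
    (hd : ∀ (m : ℕ) i j, 0 < (P ^ m) i j → d j = d i + m) {K : ℕ}
    (hK : ∀ i j, d j = d i + K → 0 < (P ^ K) i j) (i : V) :
    Tendsto (fun m : ℕ => ‖fun j => (P ^ m) j i - if d i = d j + m then p * π i else 0‖)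
      atTop (𝓝 0) := by
  have hp : (0 : ℝ) < p := Nat.cast_pos.2 (NeZero.pos p)
  have hclass := sum_cyclic_class hP hsum hπP hπ1 (fun i j h => by
    simpa using hd 1 i j (by simpa using h))
  have hPk : ∀ k i j, 0 ≤ (P ^ k) i j := fun k => pow_apply_nonneg hP k
  have hPsum := pow_apply_sum_eq_one hsum
  -- The deviation from the expected limit. Each class has mass `1 / p`, whence the factor `p`. It
  -- evolves by `P`, lives on a single class and has `π`-mean zero.
  set g : ℕ → V → ℝ := fun m j => (P ^ m) j i - if d i = d j + m then p * π i else 0 with hg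
  have hgstep : ∀ m k, g (m + k) = P ^ k *ᵥ g m := by
    intro m k
    ext j
    simp only [hg, mulVec, dotProduct, mul_sub, Finset.sum_sub_distrib]
    congr 1
    · rw [add_comm, pow_add, mul_apply]
    · have h3 : ∀ l, (P ^ k) j l * (if d i = d l + m then p * π i else 0) =
          (P ^ k) j l * (if d i = d j + (m + k : ℕ) then p * π i else 0) := by
        intro l
        rcases (hPk k j l).eq_or_lt with h0 | h0
        · simp [← h0]
        · rw [hd k j l h0]
          push_cast
          rw [add_assoc, add_comm (k : ZMod p)]
      simp only [h3, ← Finset.sum_mul, hPsum, one_mul]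
  have hgsupp : ∀ (m : ℕ) j, d i ≠ d j + m → g m j = 0 := by
    intro m j hne
    simp only [hg, if_neg hne, sub_zero]
    by_contra h0
    exact hne (hd m j i (lt_of_le_of_ne (hPk m j i) (Ne.symm h0)))
  have hgmean : ∀ m, ∑ j, π j * g m j = 0 := by
    intro m
    induction m with
    | zero =>
      simp only [hg, pow_zero, Nat.cast_zero, add_zero, mul_sub, Finset.sum_sub_distrib, one_apply,
        mul_ite, mul_one, mul_zero]
      have h1 := hclass (d i)
      have h2 : ∑ j, (if d i = d j then π j * (p * π i) else 0) =
          (∑ j, if d j = d i then π j else 0) * (p * π i) := by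
        rw [Finset.sum_mul]
        exact Finset.sum_congr rfl fun j _ => by simp [eq_comm]
      rw [h2, h1]
      simp
      field_simp
      simp
    | succ m ih => rw [hgstep m 1, pow_one, sum_stationary_mul hπP, ih]
  have hbound : ∀ (Q : Matrix V V ℝ) (c : ℝ) (f : V → ℝ), (∀ j l, 0 ≤ Q j l) →
      (∀ j, ∑ l, Q j l = c) → ‖Q *ᵥ f‖ ≤ c * ‖f‖ := by
    intro Q c f hQ hQc
    have hc : 0 ≤ c := hQc i ▸ Finset.sum_nonneg fun l _ => hQ i l
    refine (pi_norm_le_iff_of_nonneg (by positivity)).2 fun j => ?_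
    rw [← hQc j, Finset.sum_mul]
    refine (norm_sum_le _ _).trans (Finset.sum_le_sum fun l _ => ?_)
    rw [norm_mul, Real.norm_of_nonneg (hQ j l)]
    exact mul_le_mul_of_nonneg_left (norm_le_pi_norm f l) (hQ j l)
  obtain ⟨ε, hε, hεP⟩ : ∃ ε : ℝ, 0 < ε ∧ ∀ j l, d l = d j + K → ε ≤ (P ^ K) j l := by
    have : Nonempty V := ⟨i⟩
    obtain ⟨⟨j₀, l₀⟩, hmin⟩ := Finite.exists_min fun q : V × V =>
      if d q.2 = d q.1 + K then (P ^ K) q.1 q.2 else 1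
    refine ⟨_, ?_, fun j l hjl => (hmin (j, l)).trans (by simp [hjl])⟩
    dsimp only
    split_ifs with h
    · exact hK _ _ h
    · exact one_pos
  have hπle : ∀ l, π l ≤ 1 := fun l =>
    hπ1 ▸ Finset.single_le_sum (fun a _ => (hπ a).le) (Finset.mem_univ l)
  refine tendsto_zero_of_antitone_of_contraction (K := K) (θ := 1 - ε / p)
    (antitone_nat_of_succ_le fun m => ?_) (fun m => norm_nonneg _)
    (by have := div_pos hε hp; linarith) fun m => ?_
  · have := hbound _ 1 (g m) (hPk 1) (hPsum 1)
    rw [one_mul, ← hgstep] at this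
    exact this
  -- Doeblin's minorization: the subtracted part annihilates `g m`, as `g m` has mean zero and lives
  -- on one class. What remains is non-negative with row sums `1 - ε / p`.
  · let Q : Matrix V V ℝ := of fun j l => (P ^ K) j l - ε * if d l = d j + K then π l else 0
    have hQg : P ^ K *ᵥ g m = Q *ᵥ g m := by
      ext j
      simp only [Q, mulVec, dotProduct, of_apply, sub_mul, Finset.sum_sub_distrib]
      have : ∑ l, ε * (if d l = d j + K then π l else 0) * g m l = 0 := by
        simp only [mul_assoc, ← Finset.mul_sum]
        by_cases hc : d i = d j + K + m
        · have h1 : ∀ l, (if d l = d j + K then π l else 0) * g m l = π l * g m l := by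
            intro l
            split_ifs with hl
            · rfl
            · rw [hgsupp m l (fun h => hl (add_right_cancel (h.symm.trans hc)))]; simp
          simp only [h1, hgmean, mul_zero]
        · have h1 : ∀ l, (if d l = d j + K then π l else 0) * g m l = 0 := by
            intro l
            split_ifs with hl
            · rw [hgsupp m l (fun h => hc (by rw [h, hl])), mul_zero]
            · simp
          simp only [h1, Finset.sum_const_zero, mul_zero]
      rw [this, sub_zero]
    change ‖g (m + K)‖ ≤ _ * ‖g m‖
    rw [hgstep, hQg]
    refine hbound Q _ _ (fun j l => ?_) fun j => ?_
    · simp only [Q, of_apply, sub_nonneg]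
      split_ifs with hl
      · exact (mul_le_of_le_one_right hε.le (hπle l)).trans (hεP j l hl)
      · simpa using hPk K j l
    · simp only [Q, of_apply, Finset.sum_sub_distrib, ← Finset.mul_sum, hPsum, hclass]
      ring

end Stochastic

/-- The transform `A i j * v j / (r * v i)` is stochastic with stationary vector `u i * v i`, and
its powers are positive where those of `A` are. The hypothesis `hn` places `j` exactly `n` classes
after `i`, so `n + m` must be a multiple of the period for `m` steps to lead back. -/
theorem IsIrreducible.tendsto_pow_div [Nonempty V] {A : Matrix V V ℝ} (h : A.IsIrreducible)
    {r : ℝ} {u v : V → ℝ} (hr : 0 < r) (hu : ∀ i, 0 < u i) (hv : ∀ i, 0 < v i)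
    (hAu : u ᵥ* A = r • u) (hAv : A *ᵥ v = r • v) (huv : ∑ i, u i * v i = 1)
    {n : ℕ} {i j : V} (hn : 0 < (A ^ n) i j) :
    Tendsto (fun m : ℕ => (A ^ m) j i / r ^ m) (atTop ⊓ 𝓟 {m : ℕ | matrixPeriod A ∣ n + m})
      (𝓝 (matrixPeriod A * (v j * u i))) := by
  have : NeZero (matrixPeriod A) := ⟨h.matrixPeriod_pos.ne'⟩
  obtain ⟨d, hd, K, hK⟩ := h.exists_cyclic_classes
  let P : Matrix V V ℝ := of fun i j => A i j * v j / (r * v i)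
  have hPpow : ∀ m i j, (P ^ m) i j = (A ^ m) i j * (v j / (r ^ m * v i)) := by
    intro m
    induction m with
    | zero =>
      intro i j
      rcases eq_or_ne i j with rfl | hij
      · simp [(hv i).ne']
      · simp [hij]
    | succ m ih =>
      intro i j
      rw [pow_succ, mul_apply, pow_succ, mul_apply, Finset.sum_mul]
      refine Finset.sum_congr rfl fun k _ => ?_
      have := (hv k).ne'
      have := (hv i).ne'
      simp only [ih, P, of_apply, pow_succ]
      field_simp
  have hfac : ∀ m i j, 0 < v j / (r ^ m * v i) := fun m i j =>
    div_pos (hv j) (mul_pos (pow_pos hr m) (hv i))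
  have hPpos : ∀ m i j, 0 < (P ^ m) i j ↔ 0 < (A ^ m) i j := fun m i j => by
    rw [hPpow, mul_pos_iff_of_pos_right (hfac m i j)]
  have hlim := tendsto_norm_stochastic_pow_sub (P := P) (π := fun i => u i * v i) (d := d) (K := K)
    (fun i j => by
      have := mul_nonneg (h.nonneg i j) (hfac 1 i j).le
      rwa [← pow_one A, ← hPpow, pow_one] at this)
    (fun i => by
      have h1 := congrFun hAv i
      simp only [mulVec, dotProduct, Pi.smul_apply, smul_eq_mul] at h1
      simp only [P, of_apply, ← Finset.sum_div, h1]
      exact div_self (mul_pos hr (hv i)).ne')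
    (fun i => mul_pos (hu i) (hv i))
    (by
      ext j
      have h1 := congrFun hAu j
      simp only [vecMul, dotProduct, Pi.smul_apply, smul_eq_mul] at h1
      have h2 : ∀ i, u i * v i * P i j = u i * A i j * (v j / r) := by
        intro i
        have := (hv i).ne'
        simp only [P, of_apply]
        field_simp
      simp only [vecMul, dotProduct, h2, ← Finset.sum_mul, h1]
      field_simp)
    huv (fun m i j hij => hd m i j ((hPpos m i j).1 hij))
    (fun i j hij => (hPpos K i j).2 (hK K le_rfl i j hij)) i
  have hj : Tendsto (fun m : ℕ => (P ^ m) j i -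
      if d i = d j + m then matrixPeriod A * (u i * v i) else 0) atTop (𝓝 0) :=
    squeeze_zero_norm (fun m => norm_le_pi_norm (fun j => (P ^ m) j i -
      if d i = d j + m then matrixPeriod A * (u i * v i) else 0) j) hlim
  have hj' := ((hj.mono_left (inf_le_left (b := 𝓟 {m : ℕ | matrixPeriod A ∣ n + m}))).add_const
    (matrixPeriod A * (u i * v i))).mul_const (v j / v i)
  have hvi := (hv i).ne'
  have hvj := (hv j).ne'
  refine (hj'.congr' ?_).trans (le_of_eq ?_)
  · have hmem : {m : ℕ | matrixPeriod A ∣ n + m} ∈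
        atTop ⊓ 𝓟 {m : ℕ | matrixPeriod A ∣ n + m} := mem_inf_of_right (mem_principal_self _)
    filter_upwards [hmem] with m hm
    have h1 : d i = d j + m := by
      have h2 := (ZMod.natCast_eq_zero_iff _ _).2 hm
      push_cast at h2
      rw [hd n i j hn, add_assoc, h2, add_zero]
    rw [if_pos h1, sub_add_cancel, hPpow]
    field_simp
  · congr 1
    field_simp
    ring

end Matrix

/-! ### Periodic sequences, paths and words of a labeled graph -/

noncomputable section

/-- The `N`-periodic two-sided sequence that repeats the word `W`. -/
def periodicExtension {S : Type*} {N : ℕ} [NeZero N] (W : Fin N → S) : ℤ → S :=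
  fun z => W ⟨(z % N).toNat, by
    have hN : (0 : ℤ) < N := by exact_mod_cast NeZero.pos N
    have := Int.emod_lt_of_pos z hN
    have := Int.emod_nonneg z hN.ne'
    omega⟩

theorem periodicExtension_add {S : Type*} {N : ℕ} [NeZero N] (W : Fin N → S) (z : ℤ) :
    periodicExtension W (z + N) = periodicExtension W z := by
  simp [periodicExtension]

theorem periodicExtension_coe {S : Type*} {N : ℕ} [NeZero N] (W : Fin N → S) (t : Fin N) :
    periodicExtension W (t : ℤ) = W t := by
  simp only [periodicExtension]
  congr 1
  ext
  simp only
  rw [← Int.natCast_mod, Int.toNat_natCast, Nat.mod_eq_of_lt t.isLt]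

theorem eq_periodicExtension {S : Type*} {N : ℕ} [NeZero N] {x : ℤ → S}
    (hx : ∀ z, x (z + N) = x z) : x = periodicExtension fun t : Fin N => x t := by
  ext z
  have hp : Function.Periodic x N := hx
  simp only [periodicExtension]
  have hN : (0 : ℤ) < N := by exact_mod_cast NeZero.pos N
  rw [Int.toNat_of_nonneg (Int.emod_nonneg z hN.ne')]
  conv_lhs => rw [← Int.emod_add_ediv_mul z N]
  have := hp.int_mul (z / N) (z % N)
  simpa using this

theorem shiftMap_iterate {S : Type*} (m : ℕ) (x : ℤ → S) (z : ℤ) :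
    shiftMap^[m] x z = x (z + m) := by
  induction m generalizing z with
  | zero => simp
  | succ m ih =>
    rw [Function.iterate_succ_apply', shiftMap, ih]
    push_cast
    congr 1
    ring

theorem mem_periodicPoints_iff {S : Type*} {X : Set (ℤ → S)} {m : ℕ} {x : ℤ → S} :
    x ∈ periodicPoints X m ↔ x ∈ X ∧ ∀ z, x (z + m) = x z := by
  simp only [periodicPoints, Set.mem_ofPred_eq, funext_iff, shiftMap_iterate]

namespace LabeledGraph

variable {V E S : Type*}

theorem symbolAdj_pos_iff (G : LabeledGraph V E S) {s : S} {i j : V} :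
    0 < G.symbolAdj s i j ↔ ∃ e, G.src e = i ∧ G.tgt e = j ∧ G.label e = s := by
  unfold symbolAdj
  rw [Matrix.of_apply]
  split_ifs with h <;> simp [h]

theorem symbolAdj_nonneg (G : LabeledGraph V E S) (s : S) (i j : V) : 0 ≤ G.symbolAdj s i j := by
  unfold symbolAdj
  rw [Matrix.of_apply]
  split_ifs <;> simp

theorem symbolAdj_eq_one (G : LabeledGraph V E S) {s : S} {i j : V} (h : 0 < G.symbolAdj s i j) :
    G.symbolAdj s i j = 1 := by
  unfold symbolAdj at h ⊢
  rw [Matrix.of_apply] at h ⊢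
  split_ifs at h ⊢ with h'
  · rfl
  · simp at h

theorem RightResolving.symbolAdj_det {G : LabeledGraph V E S} (hG : G.RightResolving) {s : S}
    {i j j' : V} (h : 0 < G.symbolAdj s i j) (h' : 0 < G.symbolAdj s i j') : j = j' := by
  obtain ⟨e, he, rfl, hes⟩ := G.symbolAdj_pos_iff.1 h
  obtain ⟨f, hf, rfl, hfs⟩ := G.symbolAdj_pos_iff.1 h'
  rw [hG e f (he.trans hf.symm) (hes.trans hfs.symm)]

theorem mem_soficShift_iff (G : LabeledGraph V E S) {x : ℤ → S} :
    x ∈ G.soficShift ↔ ∃ q : ℤ → V, ∀ z, 0 < G.symbolAdj (x z) (q z) (q (z + 1)) := by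
  constructor
  · rintro ⟨ξ, hξ, hx⟩
    exact ⟨fun z => G.src (ξ z), fun z => G.symbolAdj_pos_iff.2 ⟨ξ z, rfl, hξ z, (hx z).symm⟩⟩
  · rintro ⟨q, hq⟩
    choose ξ h₁ h₂ h₃ using fun z => G.symbolAdj_pos_iff.1 (hq z)
    exact ⟨ξ, fun z => (h₂ z).trans (h₁ (z + 1)).symm, fun z => (h₃ z).symm⟩

theorem soficShift_translate (G : LabeledGraph V E S) {x : ℤ → S} (hx : x ∈ G.soficShift)
    (a : ℤ) : (fun z => x (z + a)) ∈ G.soficShift := by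
  obtain ⟨q, hq⟩ := G.mem_soficShift_iff.1 hx
  refine G.mem_soficShift_iff.2 ⟨fun z => q (z + a), fun z => ?_⟩
  have := hq (z + a)
  rwa [add_right_comm] at this

/-- The sofic shift is a continuous image of the edge shift, which is closed in a product of finite
discrete spaces. -/
theorem isCompact_soficShift [Finite E] [TopologicalSpace S] (G : LabeledGraph V E S) :
    IsCompact G.soficShift := by
  let : TopologicalSpace E := ⊥
  have : DiscreteTopology E := ⟨rfl⟩
  have h1 : IsClosed G.edgeShift := by
    simp only [edgeShift, Set.ofPred_forall]
    refine isClosed_iInter fun z => ?_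
    exact (isClosed_discrete {q : E × E | G.tgt q.1 = G.src q.2}).preimage
      (f := fun ξ : ℤ → E => (ξ z, ξ (z + 1))) (by fun_prop)
  have h2 : G.soficShift = (fun (ξ : ℤ → E) z => G.label (ξ z)) '' G.edgeShift := by
    ext x
    constructor
    · rintro ⟨ξ, hξ, hx⟩
      exact ⟨ξ, hξ, funext fun z => (hx z).symm⟩
    · rintro ⟨ξ, hξ, rfl⟩
      exact ⟨ξ, hξ, fun _ => rfl⟩
  rw [h2]
  exact h1.isCompact.image (continuous_pi fun z =>
    (continuous_of_discreteTopology (f := G.label)).comp (continuous_apply z))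

theorem mem_soficShift_of_forall_window [Finite E] (G : LabeledGraph V E S) {x : ℤ → S}
    (hx : ∀ M : ℕ, ∃ y ∈ G.soficShift, ∀ z : ℤ, |z| ≤ M → y z = x z) : x ∈ G.soficShift := by
  let : TopologicalSpace S := ⊥
  have : DiscreteTopology S := ⟨rfl⟩
  choose y hy hyx using hx
  refine G.isCompact_soficShift.isClosed.mem_of_tendsto (f := y) (b := atTop) ?_
    (Eventually.of_forall hy)
  refine tendsto_pi_nhds.2 fun z => tendsto_const_nhds.congr' ?_
  filter_upwards [eventually_ge_atTop z.natAbs] with M hM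
  exact (hyx M z (by rw [Int.abs_eq_natAbs]; omega)).symm

section ListAdj

variable [Fintype V] [DecidableEq V]

/-- The product of the symbol adjacency matrices along a list of symbols. -/
def listAdj (G : LabeledGraph V E S) (l : List S) : Matrix V V ℝ := (l.map G.symbolAdj).prod

theorem wordAdj_eq_listAdj (G : LabeledGraph V E S) {n : ℕ} (w : Fin n → S) :
    G.wordAdj w = G.listAdj (List.ofFn w) := by
  rw [wordAdj, listAdj, List.map_ofFn]
  rfl

@[simp] theorem listAdj_nil (G : LabeledGraph V E S) : G.listAdj [] = 1 := rfl

theorem listAdj_cons (G : LabeledGraph V E S) (s : S) (l : List S) :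
    G.listAdj (s :: l) = G.symbolAdj s * G.listAdj l := by
  simp [listAdj]

theorem listAdj_singleton (G : LabeledGraph V E S) (s : S) : G.listAdj [s] = G.symbolAdj s := by
  simp [listAdj]

theorem listAdj_append (G : LabeledGraph V E S) (l l' : List S) :
    G.listAdj (l ++ l') = G.listAdj l * G.listAdj l' := by
  simp [listAdj]

theorem wordAdj_append (G : LabeledGraph V E S) {m n : ℕ} (a : Fin m → S) (b : Fin n → S) :
    G.wordAdj (Fin.append a b) = G.wordAdj a * G.wordAdj b := by
  simp only [wordAdj_eq_listAdj, List.ofFn_fin_append, listAdj_append]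

theorem listAdj_nonneg (G : LabeledGraph V E S) (l : List S) (i j : V) : 0 ≤ G.listAdj l i j := by
  induction l generalizing i with
  | nil => rw [listAdj_nil, Matrix.one_apply]; split_ifs <;> simp
  | cons s l ih =>
    rw [listAdj_cons, Matrix.mul_apply]
    exact Finset.sum_nonneg fun k _ => mul_nonneg (G.symbolAdj_nonneg _ _ _) (ih _)

theorem wordAdj_nonneg (G : LabeledGraph V E S) {n : ℕ} (w : Fin n → S) (i j : V) :
    0 ≤ G.wordAdj w i j := by
  rw [wordAdj_eq_listAdj]
  exact G.listAdj_nonneg _ _ _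

theorem listAdj_append_pos_iff (G : LabeledGraph V E S) {l l' : List S} {i k : V} :
    0 < G.listAdj (l ++ l') i k ↔ ∃ j, 0 < G.listAdj l i j ∧ 0 < G.listAdj l' j k := by
  rw [listAdj_append, Matrix.mul_apply, Finset.sum_pos_iff_of_nonneg
    fun j _ => mul_nonneg (G.listAdj_nonneg _ _ _) (G.listAdj_nonneg _ _ _)]
  constructor
  · rintro ⟨j, -, hj⟩
    exact ⟨j, pos_of_mul_pos_left hj (G.listAdj_nonneg _ _ _),
      pos_of_mul_pos_right hj (G.listAdj_nonneg _ _ _)⟩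
  · rintro ⟨j, h₁, h₂⟩
    exact ⟨j, Finset.mem_univ _, mul_pos h₁ h₂⟩

theorem listAdj_cons_pos_iff (G : LabeledGraph V E S) {s : S} {l : List S} {i k : V} :
    0 < G.listAdj (s :: l) i k ↔ ∃ j, 0 < G.symbolAdj s i j ∧ 0 < G.listAdj l j k := by
  rw [← List.singleton_append, listAdj_append_pos_iff, listAdj_singleton]

theorem listAdj_nil_pos_iff (G : LabeledGraph V E S) {i j : V} :
    0 < G.listAdj [] i j ↔ i = j := by
  rw [listAdj_nil, Matrix.one_apply]
  split_ifs with h <;> simp [h]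

theorem RightResolving.listAdj_det {G : LabeledGraph V E S} (hG : G.RightResolving) {l : List S}
    {i j j' : V} (h : 0 < G.listAdj l i j) (h' : 0 < G.listAdj l i j') : j = j' := by
  induction l generalizing i with
  | nil => rw [listAdj_nil_pos_iff] at h h'; rw [← h, h']
  | cons s l ih =>
    obtain ⟨k, h₁, h₂⟩ := G.listAdj_cons_pos_iff.1 h
    obtain ⟨k', h₁', h₂'⟩ := G.listAdj_cons_pos_iff.1 h'
    obtain rfl := hG.symbolAdj_det h₁ h₁'
    exact ih h₂ h₂'

/-- In general these entries count paths; right-resolving leaves at most one path per initial vertex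
and label. -/
theorem RightResolving.listAdj_eq_one {G : LabeledGraph V E S} (hG : G.RightResolving)
    {l : List S} {i j : V} (h : 0 < G.listAdj l i j) : G.listAdj l i j = 1 := by
  induction l generalizing i with
  | nil => rw [listAdj_nil_pos_iff] at h; simp [h]
  | cons s l ih =>
    obtain ⟨k, h₁, h₂⟩ := G.listAdj_cons_pos_iff.1 h
    rw [listAdj_cons, Matrix.mul_apply, Finset.sum_eq_single k]
    · rw [ih h₂, G.symbolAdj_eq_one h₁, one_mul]
    · intro k' _ hne
      have : ¬ 0 < G.symbolAdj s i k' := fun h' => hne (hG.symbolAdj_det h' h₁)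
      rw [le_antisymm (not_lt.1 this) (G.symbolAdj_nonneg _ _ _), zero_mul]
    · simp

theorem listAdj_window_pos (G : LabeledGraph V E S) {x : ℤ → S} {q : ℤ → V}
    (hq : ∀ z, 0 < G.symbolAdj (x z) (q z) (q (z + 1))) (a : ℤ) (n : ℕ) :
    0 < G.listAdj (List.ofFn fun t : Fin n => x (a + t)) (q a) (q (a + n)) := by
  induction n generalizing a with
  | zero => simp
  | succ n ih =>
    rw [List.ofFn_succ, listAdj_cons_pos_iff]
    refine ⟨q (a + 1), by simpa using hq a, ?_⟩
    have := ih (a + 1)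
    convert this using 3
    · funext t; congr 1; push_cast [Fin.val_succ]; ring
    · push_cast; ring

theorem exists_states_of_listAdj_pos (G : LabeledGraph V E S) {l : List S} {i j : V}
    (h : 0 < G.listAdj l i j) :
    ∃ q : ℕ → V, q 0 = i ∧ q l.length = j ∧
      ∀ t (ht : t < l.length), 0 < G.symbolAdj l[t] (q t) (q (t + 1)) := by
  induction l generalizing i with
  | nil => exact ⟨fun _ => i, rfl, G.listAdj_nil_pos_iff.1 h, fun t ht => by simp at ht⟩
  | cons s l ih =>
    obtain ⟨k, h₁, h₂⟩ := G.listAdj_cons_pos_iff.1 h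
    obtain ⟨q, hq0, hqn, hq⟩ := ih h₂
    refine ⟨fun t => Nat.casesOn t i q, rfl, by simpa using hqn, fun t ht => ?_⟩
    cases t with
    | zero => simpa [hq0] using h₁
    | succ t => simpa using hq t (by simpa using ht)

theorem periodicExtension_mem_soficShift (G : LabeledGraph V E S) {N : ℕ} [NeZero N]
    {W : Fin N → S} {i : V} (h : 0 < G.wordAdj W i i) : periodicExtension W ∈ G.soficShift := by
  rw [wordAdj_eq_listAdj] at h
  obtain ⟨q, hq0, hqn, hq⟩ := G.exists_states_of_listAdj_pos h
  rw [List.length_ofFn] at hqn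
  have hN : (0 : ℤ) < N := by exact_mod_cast NeZero.pos N
  refine G.mem_soficShift_iff.2 ⟨fun z => q (z % N).toNat, fun z => ?_⟩
  have h1 := Int.emod_lt_of_pos z hN
  have h2 := Int.emod_nonneg z hN.ne'
  have h3 := hq (z % N).toNat (by rw [List.length_ofFn]; omega)
  rw [List.getElem_ofFn] at h3
  suffices hs : q ((z + 1) % N).toNat = q ((z % N).toNat + 1) by
    rw [← hs] at h3
    exact h3
  rcases (show z % N + 1 < N ∨ z % N + 1 = N by omega) with h4 | h4
  · have : (z + 1) % N = z % N + 1 := by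
      rw [Int.add_emod, ← Int.emod_eq_of_lt (a := z % N + 1) (b := N) (by omega) h4]
      simp [Int.add_emod]
    rw [this]
    congr 1
    omega
  · have : (z + 1) % N = 0 := by
      rw [← Int.emod_add_ediv_mul z N, show z % N + z / N * N + 1 = (z / N + 1) * N by
        linear_combination h4]
      simp
    rw [this, show (z % N).toNat + 1 = N by omega, hqn, ← hq0]
    rfl

end ListAdj

section Irreducible

variable [Fintype V] [DecidableEq V] [Fintype S]

theorem sum_wordAdj (G : LabeledGraph V E S) (n : ℕ) :
    ∑ w : Fin n → S, G.wordAdj w = G.adj ^ n := by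
  induction n with
  | zero => simp [wordAdj]
  | succ n ih =>
    rw [← (Fin.consEquiv fun _ : Fin (n + 1) => S).sum_comp, Fintype.sum_prod_type, pow_succ', ← ih,
      adj, Finset.sum_mul]
    refine Finset.sum_congr rfl fun s _ => ?_
    rw [Finset.mul_sum]
    refine Finset.sum_congr rfl fun w _ => ?_
    simp [wordAdj_eq_listAdj, Fin.consEquiv, listAdj_cons]

theorem exists_listAdj_pos_of_irreducible {G : LabeledGraph V E S} (h : G.adj.IsIrreducible)
    (i j : V) : ∃ l : List S, l ≠ [] ∧ 0 < G.listAdj l i j := by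
  obtain ⟨k, hk0, hk⟩ := h.exists_pow_pos i j
  rw [← sum_wordAdj, Matrix.sum_apply,
    Finset.sum_pos_iff_of_nonneg fun w _ => G.wordAdj_nonneg w i j] at hk
  obtain ⟨w, -, hw⟩ := hk
  refine ⟨List.ofFn w, ?_, by rwa [← wordAdj_eq_listAdj]⟩
  rw [Ne, List.ofFn_eq_nil_iff]
  omega

/-- Irreducibility closes the path to a loop, which is then repeated forever. -/
theorem exists_mem_soficShift_of_listAdj_pos {G : LabeledGraph V E S} (h : G.adj.IsIrreducible)
    {l : List S} {i j : V} (hl : 0 < G.listAdj l i j) :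
    ∃ x ∈ G.soficShift, ∀ t (ht : t < l.length), x t = l[t] := by
  obtain ⟨l', hl'0, hl'⟩ := exists_listAdj_pos_of_irreducible h j i
  have hloop : 0 < G.listAdj (l ++ l') i i := G.listAdj_append_pos_iff.2 ⟨j, hl, hl'⟩
  have : NeZero (l ++ l').length := ⟨by simp [hl'0]⟩
  have hW : 0 < G.wordAdj (l ++ l').get i i := by
    rwa [wordAdj_eq_listAdj, List.ofFn_get]
  refine ⟨_, G.periodicExtension_mem_soficShift hW, fun t ht => ?_⟩
  have h1 := periodicExtension_coe (l ++ l').get ⟨t, by rw [List.length_append]; omega⟩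
  simp only at h1
  rw [h1]
  simp [ht]

end Irreducible

end LabeledGraph
end

/-! ### Minimality, follower sets and synchronizing words -/

namespace LabeledGraph

variable {V E S : Type*}

/-- The definition compares only with graphs on `Fin m` and `Fin e`; renumbering extends it to all
finite types. -/
theorem IsMinimalRightResolving.card_le [Fintype V] {G : LabeledGraph V E S}
    (hG : G.IsMinimalRightResolving) {V' E' : Type*} [Fintype V'] [Finite E']
    (H : LabeledGraph V' E' S) (hH : H.RightResolving) (hX : H.soficShift = G.soficShift) :
    Fintype.card V ≤ Fintype.card V' := by
  let eV := Fintype.equivFin V'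
  let eE := Finite.equivFin E'
  refine hG.2 _ _ ⟨fun a => eV (H.src (eE.symm a)), fun a => eV (H.tgt (eE.symm a)),
    fun a => H.label (eE.symm a)⟩ ?_ ?_
  · intro a b hab hl
    exact eE.symm.injective (hH _ _ (eV.injective hab) hl)
  · rw [← hX]
    ext x
    constructor
    · rintro ⟨ξ, hξ, hx⟩
      exact ⟨fun z => eE.symm (ξ z), fun z => eV.injective (hξ z), hx⟩
    · rintro ⟨ξ, hξ, hx⟩
      refine ⟨fun z => eE (ξ z), fun z => ?_, fun z => ?_⟩
      · simpa using hξ z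
      · simpa using hx z

variable [Fintype V] [DecidableEq V]

/-- The labels of the finite paths that start at a vertex. -/
def follower (G : LabeledGraph V E S) (i : V) : Set (List S) := {l | ∃ k, 0 < G.listAdj l i k}

/-- After reading `s`, the new follower set is `{l | s :: l ∈ G.follower i}`, which depends on `i`
only through its follower set. -/
theorem RightResolving.follower_eq_of_step {G : LabeledGraph V E S} (hG : G.RightResolving)
    {s : S} {i i' j j' : V} (hi : G.follower i = G.follower i') (hj : 0 < G.symbolAdj s i j)
    (hj' : 0 < G.symbolAdj s i' j') : G.follower j = G.follower j' := by
  have key : ∀ {a b : V}, 0 < G.symbolAdj s a b →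
      ∀ l, l ∈ G.follower b ↔ s :: l ∈ G.follower a := by
    intro a b hab l
    constructor
    · rintro ⟨k, hk⟩
      exact ⟨k, G.listAdj_cons_pos_iff.2 ⟨b, hab, hk⟩⟩
    · rintro ⟨k, hk⟩
      obtain ⟨c, hc, hck⟩ := G.listAdj_cons_pos_iff.1 hk
      exact ⟨k, hG.symbolAdj_det hc hab ▸ hck⟩
  ext l
  rw [key hj, key hj', hi]

/-- The graph obtained by merging the vertices with the same follower set. -/
def mergedGraph (G : LabeledGraph V E S) :
    LabeledGraph (Set.range G.follower)
      {e : Set.range G.follower × S × Set.range G.follower //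
        ∃ i j, G.follower i = e.1 ∧ G.follower j = e.2.2 ∧ 0 < G.symbolAdj e.2.1 i j} S where
  src e := e.1.1
  tgt e := e.1.2.2
  label e := e.1.2.1

theorem symbolAdj_mergedGraph_pos_iff (G : LabeledGraph V E S) {s : S}
    {a b : Set.range G.follower} : 0 < G.mergedGraph.symbolAdj s a b ↔
      ∃ i j, G.follower i = a ∧ G.follower j = b ∧ 0 < G.symbolAdj s i j := by
  rw [symbolAdj_pos_iff]
  constructor
  · rintro ⟨⟨⟨a, t, b⟩, he⟩, rfl, rfl, rfl⟩
    exact he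
  · intro he
    exact ⟨⟨⟨a, s, b⟩, he⟩, rfl, rfl, rfl⟩

theorem RightResolving.mergedGraph {G : LabeledGraph V E S} (hG : G.RightResolving) :
    G.mergedGraph.RightResolving := by
  rintro ⟨⟨a, s, b⟩, i, j, hi, hj, hij⟩ ⟨⟨a', s', b'⟩, i', j', hi', hj', hij'⟩ h₁ h₂
  obtain rfl : a = a' := h₁
  obtain rfl : s = s' := h₂
  have : b = b' := Subtype.ext (hj.symm.trans
    ((hG.follower_eq_of_step (hi.trans hi'.symm) hij hij').trans hj'))
  subst this
  rfl

/-- A finite merged path lifts to `G` from any representative of its initial class, because equal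
follower sets allow the same next symbol and stay equal. Each finite window thus extends to a point
of the shift, and compactness gives the whole sequence. -/
theorem soficShift_mergedGraph [Fintype S] [Finite E] {G : LabeledGraph V E S}
    (hG : G.RightResolving) (hirr : G.adj.IsIrreducible) :
    G.mergedGraph.soficShift = G.soficShift := by
  ext x
  constructor
  · intro hx
    obtain ⟨q, hq⟩ := G.mergedGraph.mem_soficShift_iff.1 hx
    have hpath : ∀ (n : ℕ) (a : ℤ) (i : V), G.follower i = q a →
        (List.ofFn fun t : Fin n => x (a + t)) ∈ G.follower i := by
      intro n
      induction n with
      | zero => exact fun a i _ => ⟨i, by simp⟩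
      | succ n ih =>
        intro a i hi
        obtain ⟨i', j', hi', hj', hs⟩ := G.symbolAdj_mergedGraph_pos_iff.1 (hq a)
        have h1 : [x a] ∈ G.follower i := by
          rw [hi, ← hi']
          exact ⟨j', by rwa [listAdj_singleton]⟩
        obtain ⟨j, hj⟩ := h1
        rw [listAdj_singleton] at hj
        have hjq : G.follower j = q (a + 1) :=
          (hG.follower_eq_of_step (hi.trans hi'.symm) hj hs).trans hj'
        obtain ⟨k, hk⟩ := ih (a + 1) j hjq
        refine ⟨k, ?_⟩
        rw [List.ofFn_succ, listAdj_cons_pos_iff]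
        refine ⟨j, by simpa using hj, ?_⟩
        convert hk using 5 with t
        push_cast [Fin.val_succ]
        ring
    refine G.mem_soficShift_of_forall_window fun M => ?_
    obtain ⟨i, hi⟩ := (q (-M)).2
    obtain ⟨k, hk⟩ := hpath (2 * M + 1) (-M) i hi
    obtain ⟨y, hy, hyx⟩ := exists_mem_soficShift_of_listAdj_pos hirr hk
    refine ⟨_, G.soficShift_translate hy M, fun z hz => ?_⟩
    obtain ⟨h1, h2⟩ := abs_le.1 hz
    obtain ⟨t, ht⟩ := Int.eq_ofNat_of_zero_le (show 0 ≤ z + M by omega)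
    have h3 := hyx t (by rw [List.length_ofFn]; omega)
    rw [List.getElem_ofFn] at h3
    simp only at h3 ⊢
    rw [ht]
    rw [h3]
    congr 1
    omega
  · intro hx
    obtain ⟨q, hq⟩ := G.mem_soficShift_iff.1 hx
    exact G.mergedGraph.mem_soficShift_iff.2 ⟨fun z => ⟨G.follower (q z), q z, rfl⟩,
      fun z => G.symbolAdj_mergedGraph_pos_iff.2 ⟨q z, q (z + 1), rfl, rfl, hq z⟩⟩

/-- Otherwise the merged graph would be a smaller right-resolving presentation. -/
theorem IsMinimalRightResolving.follower_injective [Fintype S] [Finite E] {G : LabeledGraph V E S}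
    (hG : G.IsMinimalRightResolving) (hirr : G.adj.IsIrreducible) :
    Function.Injective G.follower := by
  classical
  have h1 := hG.card_le G.mergedGraph hG.1.mergedGraph (soficShift_mergedGraph hG.1 hirr)
  have h2 := (Fintype.bijective_iff_surjective_and_card (Set.rangeFactorization G.follower)).2
    ⟨Set.rangeFactorization_surjective,
      h1.antisymm (Fintype.card_le_of_surjective _ Set.rangeFactorization_surjective)⟩
  exact fun i j hij => h2.1 (Subtype.ext hij)

/-- A word of minimal positive rank in a right-resolving graph with separated follower sets
synchronizes. -/
theorem RightResolving.exists_synchronizing_word [Nonempty V] {G : LabeledGraph V E S}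
    (hG : G.RightResolving) (hF : Function.Injective G.follower) :
    ∃ l : List S, (∃ i j, 0 < G.listAdj l i j) ∧
      ∀ i j i' j', 0 < G.listAdj l i j → 0 < G.listAdj l i' j' → j = j' := by
  let T : List S → Set V := fun l => {j | ∃ i, 0 < G.listAdj l i j}
  have hT0 : (T []).Nonempty := by
    obtain ⟨i⟩ := ‹Nonempty V›
    exact ⟨i, i, by simp⟩
  obtain ⟨l, hl, hmin⟩ := exists_minimalFor_of_wellFoundedLT (fun l => (T l).Nonempty)
    (fun l => (T l).ncard) ⟨[], hT0⟩
  refine ⟨l, by obtain ⟨j, i, hij⟩ := hl; exact ⟨i, j, hij⟩, ?_⟩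
  -- If `l'` can be read from `j` but not from `j'`, then `l ++ l'` still labels a path but has
  -- fewer terminal vertices than `l`, as `j'` is lost.
  have hsep : ∀ j ∈ T l, ∀ j' ∈ T l, G.follower j ⊆ G.follower j' := by
    intro j hj j' hj' l' hl'
    by_contra hnot
    choose! f hf using fun k (hk : l' ∈ G.follower k) => hk
    have hsub : T (l ++ l') ⊆ f '' (T l \ {j'}) := by
      rintro k ⟨i, hik⟩
      obtain ⟨m, hm, hmk⟩ := G.listAdj_append_pos_iff.1 hik
      refine ⟨m, ⟨⟨i, hm⟩, ?_⟩, hG.listAdj_det (hf m ⟨k, hmk⟩) hmk⟩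
      rintro rfl
      exact hnot ⟨k, hmk⟩
    have hne : (T (l ++ l')).Nonempty := by
      obtain ⟨k, hk⟩ := hl'
      obtain ⟨i, hi⟩ := hj
      exact ⟨k, i, G.listAdj_append_pos_iff.2 ⟨j, hi, hk⟩⟩
    have hlt : (T (l ++ l')).ncard < (T l).ncard :=
      ((Set.ncard_le_ncard hsub).trans (Set.ncard_image_le)).trans_lt
        (Set.ncard_sdiff_singleton_lt_of_mem hj')
    exact absurd (hmin hne hlt.le) (not_le.2 hlt)
  intro i j i' j' h h'
  exact hF (Set.Subset.antisymm (hsep j ⟨i, h⟩ j' ⟨i', h'⟩) (hsep j' ⟨i', h'⟩ j ⟨i, h⟩))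

end LabeledGraph

/-! ### Paths whose label avoids a word -/

noncomputable section

namespace LabeledGraph

variable {V E S : Type*} [Fintype V] [DecidableEq V] [Fintype S]

open Classical in
/-- The number of paths of length `N` from `i` to `j` whose label avoids the word `l`. -/
def avoidingAdj (G : LabeledGraph V E S) (l : List S) (N : ℕ) : Matrix V V ℝ :=
  ∑ W : Fin N → S, if l <:+: List.ofFn W then 0 else G.wordAdj W

theorem avoidingAdj_nonneg (G : LabeledGraph V E S) (l : List S) (N : ℕ) (i j : V) :
    0 ≤ G.avoidingAdj l N i j := by
  rw [avoidingAdj, Matrix.sum_apply]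
  refine Finset.sum_nonneg fun W _ => ?_
  split_ifs
  · simp
  · exact G.wordAdj_nonneg W i j

/-- Both halves of an avoiding word avoid `l`; the converse fails when `l` straddles the cut, hence
only an inequality. -/
theorem avoidingAdj_add_le (G : LabeledGraph V E S) (l : List S) (m N : ℕ) (i j : V) :
    G.avoidingAdj l (m + N) i j ≤ (G.avoidingAdj l m * G.avoidingAdj l N) i j := by
  simp only [avoidingAdj, Finset.sum_mul_sum, Matrix.sum_apply]
  rw [← (Fin.appendEquiv m N).sum_comp, Fintype.sum_prod_type]
  refine Finset.sum_le_sum fun a _ => Finset.sum_le_sum fun b _ => ?_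
  rw [show Fin.appendEquiv m N (a, b) = Fin.append a b from rfl]
  by_cases h : l <:+: List.ofFn (Fin.append a b)
  · rw [if_pos h]
    split_ifs
    · simp
    · simp
    · simp
    · rw [← wordAdj_append]
      exact G.wordAdj_nonneg _ i j
  · rw [if_neg h, wordAdj_append]
    rw [List.ofFn_fin_append] at h
    have ha : ¬ l <:+: List.ofFn a := fun h' => h (h'.trans (List.prefix_append _ _).isInfix)
    have hb : ¬ l <:+: List.ofFn b := fun h' => h (h'.trans (List.suffix_append _ _).isInfix)
    rw [if_neg ha, if_neg hb]

theorem avoidingAdj_add_wordAdj_le (G : LabeledGraph V E S) {l : List S} {m : ℕ} {w : Fin m → S}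
    (hw : l <:+: List.ofFn w) (i j : V) :
    G.avoidingAdj l m i j + G.wordAdj w i j ≤ (G.adj ^ m) i j := by
  classical
  rw [← sum_wordAdj, avoidingAdj, Matrix.sum_apply, Matrix.sum_apply,
    ← Finset.add_sum_erase _ _ (Finset.mem_univ w), ← Finset.add_sum_erase (a := w) _
      (fun c => G.wordAdj c i j) (Finset.mem_univ w), if_pos hw, Matrix.zero_apply, zero_add,
    add_comm]
  refine add_le_add le_rfl (Finset.sum_le_sum fun W _ => ?_)
  split_ifs
  · exact G.wordAdj_nonneg W i j
  · exact le_rfl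

theorem avoidingAdj_le (G : LabeledGraph V E S) (l : List S) (m : ℕ) (i j : V) :
    G.avoidingAdj l m i j ≤ (G.adj ^ m) i j := by
  rw [← sum_wordAdj, avoidingAdj, Matrix.sum_apply, Matrix.sum_apply]
  refine Finset.sum_le_sum fun W _ => ?_
  split_ifs
  · exact G.wordAdj_nonneg W i j
  · exact le_rfl

/-- In an irreducible graph the proportion of paths whose label avoids a fixed word vanishes. -/
theorem tendsto_avoidingAdj_mulVec_div [Nonempty V] {G : LabeledGraph V E S}
    (hirr : G.adj.IsIrreducible) {l : List S} (hl : ∃ i j, 0 < G.listAdj l i j) {r : ℝ}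
    {v : V → ℝ} (hr : 0 < r) (hv : ∀ i, 0 < v i) (hAv : G.adj.mulVec v = r • v) (i : V) :
    Tendsto (fun N => (G.avoidingAdj l N).mulVec v i / r ^ N) atTop (𝓝 0) := by
  set b : ℕ → V → ℝ := fun N i => (G.avoidingAdj l N).mulVec v i / r ^ N with hb
  have hb0 : ∀ N i, 0 ≤ b N i := fun N i => div_nonneg
    (Finset.sum_nonneg fun j _ => mul_nonneg (G.avoidingAdj_nonneg l N i j) (hv j).le)
    (pow_pos hr N).le
  have hbadd : ∀ m N i, b (m + N) i ≤ (∑ k, G.avoidingAdj l m i k * b N k) / r ^ m := by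
    intro m N i
    have h1 : (G.avoidingAdj l (m + N)).mulVec v i ≤
        (G.avoidingAdj l m * G.avoidingAdj l N).mulVec v i :=
      Finset.sum_le_sum fun j _ =>
        mul_le_mul_of_nonneg_right (G.avoidingAdj_add_le l m N i j) (hv j).le
    rw [← Matrix.mulVec_mulVec] at h1
    have h2 : ∑ k, G.avoidingAdj l m i k * b N k =
        (G.avoidingAdj l m).mulVec ((G.avoidingAdj l N).mulVec v) i / r ^ N := by
      rw [Matrix.mulVec, dotProduct, Finset.sum_div]
      exact Finset.sum_congr rfl fun k _ => by rw [hb]; ring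
    rw [h2, div_div, ← pow_add, add_comm N m]
    exact div_le_div_of_nonneg_right h1 (pow_pos hr _).le
  have hanti : ∀ i, Antitone fun N => b N i := by
    intro i
    refine antitone_nat_of_succ_le fun N => ?_
    have h1 : ∀ k, b 1 k ≤ v k := by
      intro k
      simp only [hb, pow_one, div_le_iff₀ hr]
      rw [mul_comm, ← smul_eq_mul, ← Pi.smul_apply, ← hAv]
      refine Finset.sum_le_sum fun j _ => mul_le_mul_of_nonneg_right ?_ (hv j).le
      simpa using G.avoidingAdj_le l 1 k j
    refine (hbadd N 1 i).trans (div_le_div_of_nonneg_right ?_ (pow_pos hr _).le)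
    exact Finset.sum_le_sum fun k _ =>
      mul_le_mul_of_nonneg_left (h1 k) (G.avoidingAdj_nonneg l N i k)
  have hlim : ∀ i, Tendsto (fun N => b N i) atTop (𝓝 (⨅ N, b N i)) := fun i =>
    tendsto_atTop_ciInf (hanti i) ⟨0, by rintro _ ⟨N, rfl⟩; exact hb0 N i⟩
  set β : V → ℝ := fun i => ⨅ N, b N i with hβ
  have hβ0 : ∀ i, 0 ≤ β i := fun i => ge_of_tendsto' (hlim i) fun N => hb0 N i
  obtain ⟨i₀, hi₀⟩ := Finite.exists_max fun i => β i / v i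
  set c := β i₀ / v i₀ with hc
  have hβc : ∀ i, β i ≤ c * v i := fun i => (div_le_iff₀ (hv i)).1 (hi₀ i)
  have hβi₀ : β i₀ = c * v i₀ := by rw [hc, div_mul_cancel₀ _ (hv i₀).ne']
  -- The limit satisfies `β ≤ c v` with equality at `i₀`. If `c > 0`, the path from `i₀` labeled by
  -- a word `w` containing `l` is counted by `G.adj ^ m` but not by `avoidingAdj`, which makes the
  -- inequality at `i₀` strict.
  have hc0 : c ≤ 0 := by
    by_contra! hcpos
    obtain ⟨k, k', hkk'⟩ := hl
    obtain ⟨l₁, -, hl₁⟩ := exists_listAdj_pos_of_irreducible hirr i₀ k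
    obtain ⟨m, w, hinf, hpos⟩ : ∃ (m : ℕ) (w : Fin m → S), l <:+: List.ofFn w ∧
        0 < G.wordAdj w i₀ k' := by
      refine ⟨_, (l₁ ++ l).get, ?_, ?_⟩
      · rw [List.ofFn_get]
        exact (List.suffix_append _ _).isInfix
      · rw [wordAdj_eq_listAdj, List.ofFn_get]
        exact G.listAdj_append_pos_iff.2 ⟨k, hl₁, hkk'⟩
    have h1 : β i₀ ≤ (∑ k, G.avoidingAdj l m i₀ k * β k) / r ^ m := by
      refine le_of_tendsto_of_tendsto'
        ((hlim i₀).comp (tendsto_atTop_mono (fun N => Nat.le_add_left N m) tendsto_id))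
        ((tendsto_finsetSum _ fun k _ => (hlim k).const_mul _).div_const _) fun N => hbadd m N i₀
    have h2 : ∑ k, G.avoidingAdj l m i₀ k * β k <
        c * ∑ k, (G.adj ^ m) i₀ k * v k := by
      rw [Finset.mul_sum]
      have h3 : ∀ k, G.avoidingAdj l m i₀ k * β k + c * (G.wordAdj w i₀ k * v k) ≤
          c * ((G.adj ^ m) i₀ k * v k) := by
        intro k
        have h4 := mul_le_mul_of_nonneg_left (hβc k) (G.avoidingAdj_nonneg l m i₀ k)
        have h5 := mul_le_mul_of_nonneg_right (G.avoidingAdj_add_wordAdj_le hinf i₀ k)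
          (mul_pos hcpos (hv k)).le
        linarith
      refine Finset.sum_lt_sum (fun k _ => ?_) ⟨k', Finset.mem_univ _, ?_⟩
      · have := mul_nonneg hcpos.le (mul_nonneg (G.wordAdj_nonneg w i₀ k) (hv k).le)
        linarith [h3 k]
      · have := mul_pos hcpos (mul_pos hpos (hv k'))
        linarith [h3 k']
    have h6 := congrFun (Matrix.pow_mulVec_of_mulVec_eq_smul hAv m) i₀
    simp only [Matrix.mulVec, dotProduct, Pi.smul_apply, smul_eq_mul] at h6
    rw [h6] at h2
    have h7 := (div_lt_div_iff_of_pos_right (pow_pos hr m)).2 h2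
    rw [show c * (r ^ m * v i₀) / r ^ m = c * v i₀ by
      have := (pow_pos hr m).ne'
      field_simp, ← hβi₀] at h7
    exact absurd (h1.trans_lt h7) (lt_irrefl _)
  have : β i = 0 := le_antisymm
    ((hβc i).trans (mul_nonpos_of_nonpos_of_nonneg hc0 (hv i).le)) (hβ0 i)
  have h := hlim i
  rwa [show (⨅ N, b N i) = 0 from this] at h

theorem tendsto_sum_avoidingAdj_div [Nonempty V] {G : LabeledGraph V E S}
    (hirr : G.adj.IsIrreducible) {l : List S} (hl : ∃ i j, 0 < G.listAdj l i j) {r : ℝ}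
    {v : V → ℝ} (hr : 0 < r) (hv : ∀ i, 0 < v i) (hAv : G.adj.mulVec v = r • v) :
    Tendsto (fun N => (∑ i, ∑ j, G.avoidingAdj l N i j) / r ^ N) atTop (𝓝 0) := by
  have h1 : Tendsto (fun N => ∑ i, ∑ j, (G.avoidingAdj l N).mulVec v i / r ^ N / v j) atTop
      (𝓝 0) := by
    rw [show (0 : ℝ) = ∑ i : V, ∑ j, 0 / v j by simp]
    exact tendsto_finsetSum _ fun i _ => tendsto_finsetSum _ fun j _ =>
      (tendsto_avoidingAdj_mulVec_div hirr hl hr hv hAv i).div_const _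
  refine squeeze_zero (fun N => div_nonneg (Finset.sum_nonneg fun i _ => Finset.sum_nonneg fun j _ =>
    G.avoidingAdj_nonneg l N i j) (pow_pos hr N).le) (fun N => ?_) h1
  rw [Finset.sum_div]
  refine Finset.sum_le_sum fun i _ => ?_
  rw [Finset.sum_div]
  refine Finset.sum_le_sum fun j _ => ?_
  rw [le_div_iff₀ (hv j), div_mul_eq_mul_div]
  refine div_le_div_of_nonneg_right ?_ (pow_pos hr N).le
  exact Finset.single_le_sum (f := fun j => G.avoidingAdj l N i j * v j)
    (fun k _ => mul_nonneg (G.avoidingAdj_nonneg l N i k) (hv k).le) (Finset.mem_univ j)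

end LabeledGraph
end

/-! ### Counting periodic points by traces -/

noncomputable section

/-- The points of period `N` in the cylinder of `w` at the site `α`. -/
def periodicCylinder {S : Type*} (X : Set (ℤ → S)) (N : ℕ) (α : ℤ) {n : ℕ} (w : Fin n → S) :
    Set (ℤ → S) :=
  {x | x ∈ periodicPoints X N ∧ ∀ i : Fin n, x (α + i) = w i}

theorem periodicCylinder_finZero {S : Type*} (X : Set (ℤ → S)) (N : ℕ) (α : ℤ) (w : Fin 0 → S) :
    periodicCylinder X N α w = periodicPoints X N := by
  simp [periodicCylinder]

theorem periodicPoints_finite {S : Type*} [Finite S] (X : Set (ℤ → S)) (N : ℕ) [NeZero N] :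
    (periodicPoints X N).Finite := by
  refine (Set.finite_range (periodicExtension : (Fin N → S) → ℤ → S)).subset fun x hx => ?_
  exact ⟨_, (eq_periodicExtension (mem_periodicPoints_iff.1 hx).2).symm⟩

/-- The window is one symbol longer than the period, so it determines the periodic point. The count
therefore depends on `k` and `l` only through `k + l`. With `0 < n` and `0 < k` the period is
positive. -/
theorem ncard_periodicFiniteCylinder {S : Type*} (X : Set (ℤ → S)) {k l n : ℕ} (hn : 0 < n)
    (hk : 0 < k) (w : Fin n → S) :
    (periodicFiniteCylinder X k l w).ncard = (periodicCylinder X (n + k + l - 1) 1 w).ncard := by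
  have hN : NeZero (n + k + l - 1) := ⟨by omega⟩
  have himg : periodicFiniteCylinder X k l w =
      (fun (x : ℤ → S) (t : Fin (n + k + l)) => x ((t : ℤ) - k + 1)) ''
        periodicCylinder X (n + k + l - 1) 1 w := by
    ext y
    constructor
    · rintro ⟨⟨-, hy⟩, x, hx, hxy⟩
      refine ⟨x, ⟨hx, fun i => ?_⟩, funext hxy⟩
      rw [← hy i, ← hxy]
      congr 1
      push_cast
      ring
    · rintro ⟨x, ⟨hx, hxw⟩, rfl⟩
      refine ⟨⟨⟨x, hx.1, -k + 1, fun t => ?_⟩, fun i => ?_⟩, x, hx, fun t => rfl⟩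
      · dsimp only
        congr 1
        ring
      · rw [← hxw i]
        dsimp only
        congr 1
        push_cast
        ring
  rw [himg, Set.InjOn.ncard_image]
  rintro x ⟨hx, -⟩ y ⟨hy, -⟩ hxy
  have hx' := (mem_periodicPoints_iff.1 hx).2
  have hy' := (mem_periodicPoints_iff.1 hy).2
  have key : (fun z => x (z + (-k + 1))) = fun z => y (z + (-k + 1)) := by
    rw [eq_periodicExtension (N := n + k + l - 1) (x := fun z => x (z + (-k + 1)))
      (fun z => by rw [add_right_comm, hx']),
      eq_periodicExtension (N := n + k + l - 1) (x := fun z => y (z + (-k + 1)))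
      (fun z => by rw [add_right_comm, hy'])]
    congr 1
    funext t
    have := congrFun hxy ⟨t, by have := t.isLt; omega⟩
    simp only at this
    rwa [sub_add_eq_add_sub, sub_eq_add_neg, add_assoc, add_comm 1] at this
  funext z
  have := congrFun key (z - (-k + 1))
  simpa using this

namespace LabeledGraph

variable {V E S : Type*}

theorem ncard_periodicCylinder_eq (G : LabeledGraph V E S) (N : ℕ) (α β : ℤ) {n : ℕ}
    (w : Fin n → S) : (periodicCylinder G.soficShift N α w).ncard =
      (periodicCylinder G.soficShift N β w).ncard := by
  have himg : periodicCylinder G.soficShift N β w =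
      (fun (x : ℤ → S) z => x (z + (α - β))) '' periodicCylinder G.soficShift N α w := by
    have hmaps : ∀ {a b : ℤ} {x : ℤ → S}, x ∈ periodicCylinder G.soficShift N a w →
        (fun z => x (z + (a - b))) ∈ periodicCylinder G.soficShift N b w := by
      rintro a b x ⟨hx, hxw⟩
      obtain ⟨h1, h2⟩ := mem_periodicPoints_iff.1 hx
      refine ⟨mem_periodicPoints_iff.2 ⟨G.soficShift_translate h1 _, fun z => ?_⟩, fun i => ?_⟩
      · rw [add_right_comm, h2]
      · rw [← hxw i]
        dsimp only
        congr 1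
        ring
    ext y
    constructor
    · intro hy
      refine ⟨_, hmaps (b := α) hy, ?_⟩
      funext z
      simp only
      congr 1
      ring
    · rintro ⟨x, hx, rfl⟩
      exact hmaps hx
  rw [himg, Set.ncard_image_of_injective]
  intro x y hxy
  funext z
  simpa using congrFun hxy (z - (α - β))

open Classical in
theorem ncard_periodicCylinder_eq_sum [Fintype S] (G : LabeledGraph V E S) {n m : ℕ}
    [NeZero (n + m)] (w : Fin n → S) :
    ((periodicCylinder G.soficShift (n + m) 0 w).ncard : ℝ) =
      ∑ b : Fin m → S, if periodicExtension (Fin.append w b) ∈ G.soficShift then (1 : ℝ) else 0 := by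
  have himg : periodicCylinder G.soficShift (n + m) 0 w =
      (fun b : Fin m → S => periodicExtension (Fin.append w b)) ''
        {b | periodicExtension (Fin.append w b) ∈ G.soficShift} := by
    ext x
    constructor
    · rintro ⟨hx, hxw⟩
      obtain ⟨h1, h2⟩ := mem_periodicPoints_iff.1 hx
      have h3 : x = periodicExtension (Fin.append w fun t : Fin m => x (n + t)) := by
        conv_lhs => rw [eq_periodicExtension (N := n + m) h2]
        congr 1
        funext t
        refine Fin.addCases (fun i => ?_) (fun i => ?_) t
        · rw [Fin.append_left, ← hxw i, zero_add]
          simp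
        · rw [Fin.append_right]
          simp
      exact ⟨_, by rw [Set.mem_ofPred_eq, ← h3]; exact h1, h3.symm⟩
    · rintro ⟨b, hb, rfl⟩
      refine ⟨mem_periodicPoints_iff.2 ⟨hb, periodicExtension_add _⟩, fun i => ?_⟩
      have := periodicExtension_coe (Fin.append w b) (Fin.castAdd m i)
      rw [Fin.append_left] at this
      rw [← this, zero_add]
      simp
  rw [himg, Set.ncard_image_of_injective]
  · rw [Finset.sum_boole, Set.ncard_eq_toFinset_card', Set.toFinset_ofPred]
  · intro b b' hbb
    funext t
    have h1 := periodicExtension_coe (Fin.append w b) (Fin.natAdd n t)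
    have h2 := periodicExtension_coe (Fin.append w b') (Fin.natAdd n t)
    rw [Fin.append_right] at h1 h2
    rw [← h1, ← h2]
    exact congrFun hbb _

variable [Fintype V] [DecidableEq V]

open Classical in
/-- If `W` contains a synchronizing word, its periodic extension lies in the sofic shift exactly
when `W` labels a loop, and then the loop is unique. -/
theorem abs_indicator_sub_trace_le {G : LabeledGraph V E S} (hG : G.RightResolving) {l : List S}
    (hl : ∀ i j i' j', 0 < G.listAdj l i j → 0 < G.listAdj l i' j' → j = j') {N : ℕ} [NeZero N]
    (W : Fin N → S) :
    |(if periodicExtension W ∈ G.soficShift then (1 : ℝ) else 0) - (G.wordAdj W).trace| ≤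
      ∑ i, ∑ j, (if l <:+: List.ofFn W then (0 : Matrix V V ℝ) else G.wordAdj W) i j := by
  -- Reading `W` twice in succession: if `W` synchronizes, both readings end at the same vertex, so
  -- the second one is a loop.
  have hpos : periodicExtension W ∈ G.soficShift →
      ∃ i j k, 0 < G.listAdj (List.ofFn W) i j ∧ 0 < G.listAdj (List.ofFn W) j k := by
    intro hX
    obtain ⟨q, hq⟩ := G.mem_soficShift_iff.1 hX
    refine ⟨q 0, q N, q (N + N), ?_, ?_⟩
    · have := G.listAdj_window_pos hq 0 N
      simpa only [zero_add, periodicExtension_coe] using this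
    · have := G.listAdj_window_pos hq N N
      simpa only [add_comm (N : ℤ), periodicExtension_add, periodicExtension_coe] using this
  have hdiag : ∀ i, 0 ≤ G.wordAdj W i i := fun i => G.wordAdj_nonneg W i i
  split_ifs with hX hW hW
  · obtain ⟨i, j, k, hij, hjk⟩ := hpos hX
    have hsync : ∀ {a b a' b'}, 0 < G.listAdj (List.ofFn W) a b →
        0 < G.listAdj (List.ofFn W) a' b' → b = b' := by
      obtain ⟨s, t, hst⟩ := hW
      rw [← hst]
      intro a b a' b' h h'
      obtain ⟨c, hc, hcb⟩ := G.listAdj_append_pos_iff.1 h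
      obtain ⟨c', hc', hcb'⟩ := G.listAdj_append_pos_iff.1 h'
      obtain ⟨e, -, hec⟩ := G.listAdj_append_pos_iff.1 hc
      obtain ⟨e', -, hec'⟩ := G.listAdj_append_pos_iff.1 hc'
      obtain rfl := hl _ _ _ _ hec hec'
      exact hG.listAdj_det hcb hcb'
    obtain rfl := hsync hij hjk
    have htr : (G.wordAdj W).trace = 1 := by
      rw [Matrix.trace, Finset.sum_eq_single j]
      · rw [Matrix.diag_apply, wordAdj_eq_listAdj, hG.listAdj_eq_one hjk]
      · intro a _ ha
        by_contra hne
        have h1 : 0 < G.wordAdj W a a := lt_of_le_of_ne (hdiag a) (Ne.symm hne)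
        rw [wordAdj_eq_listAdj] at h1
        exact ha (hsync h1 hjk)
      · simp
    simp [htr]
  -- Without a synchronizing word, both the indicator and the trace lie between `0` and the number
  -- of paths labeled `W`.
  · obtain ⟨i, j, k, hij, -⟩ := hpos hX
    have h1 : (1 : ℝ) ≤ ∑ i, ∑ j, G.wordAdj W i j := by
      rw [← hG.listAdj_eq_one hij, ← wordAdj_eq_listAdj]
      exact (Finset.single_le_sum (fun b _ => G.wordAdj_nonneg W i b) (Finset.mem_univ j)).trans
        (Finset.single_le_sum (f := fun a => ∑ b, G.wordAdj W a b)
          (fun a _ => Finset.sum_nonneg fun b _ => G.wordAdj_nonneg W a b) (Finset.mem_univ i))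
    have h2 : (G.wordAdj W).trace ≤ ∑ i, ∑ j, G.wordAdj W i j :=
      Finset.sum_le_sum fun a _ =>
        Finset.single_le_sum (fun b _ => G.wordAdj_nonneg W a b) (Finset.mem_univ a)
    have h3 : 0 ≤ (G.wordAdj W).trace := Finset.sum_nonneg fun a _ => hdiag a
    rw [abs_le]
    constructor <;> linarith
  all_goals
    have htr : (G.wordAdj W).trace = 0 := Finset.sum_eq_zero fun a _ => by
      by_contra hne
      exact hX (G.periodicExtension_mem_soficShift (lt_of_le_of_ne (hdiag a) (Ne.symm hne)))
    simp only [htr, sub_zero, abs_zero]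
  · simp
  · exact Finset.sum_nonneg fun a _ => Finset.sum_nonneg fun b _ => G.wordAdj_nonneg W a b

theorem abs_ncard_periodicCylinder_sub_trace_le [Fintype S] {G : LabeledGraph V E S}
    (hG : G.RightResolving) {l : List S}
    (hl : ∀ i j i' j', 0 < G.listAdj l i j → 0 < G.listAdj l i' j' → j = j') {n m : ℕ}
    [NeZero (n + m)] (w : Fin n → S) :
    |((periodicCylinder G.soficShift (n + m) 0 w).ncard : ℝ) -
        (G.wordAdj w * G.adj ^ m).trace| ≤ ∑ i, ∑ j, G.avoidingAdj l (n + m) i j := by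
  classical
  let F : (Fin (n + m) → S) → ℝ := fun W =>
    ∑ i, ∑ j, (if l <:+: List.ofFn W then (0 : Matrix V V ℝ) else G.wordAdj W) i j
  have hF : ∀ W, 0 ≤ F W := fun W => (abs_nonneg _).trans (abs_indicator_sub_trace_le hG hl W)
  have hright : ∑ i, ∑ j, G.avoidingAdj l (n + m) i j = ∑ W, F W := by
    simp only [avoidingAdj, F, Matrix.sum_apply]
    rw [Finset.sum_congr rfl fun i _ => Finset.sum_comm, Finset.sum_comm]
  rw [ncard_periodicCylinder_eq_sum, ← sum_wordAdj, Finset.mul_sum, Matrix.trace_sum,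
    ← Finset.sum_sub_distrib, hright]
  calc _ ≤ ∑ b : Fin m → S, F (Fin.append w b) := by
        refine (Finset.abs_sum_le_sum_abs _ _).trans (Finset.sum_le_sum fun b _ => ?_)
        rw [← wordAdj_append]
        exact abs_indicator_sub_trace_le hG hl _
    _ ≤ ∑ a : Fin n → S, ∑ b : Fin m → S, F (Fin.append a b) :=
        Finset.single_le_sum (f := fun a : Fin n → S => ∑ b : Fin m → S, F (Fin.append a b))
          (fun a _ => Finset.sum_nonneg fun b _ => hF _) (Finset.mem_univ w)
    _ = ∑ W, F W := by
        rw [← (Fin.appendEquiv n m).sum_comp, Fintype.sum_prod_type]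
        rfl

end LabeledGraph
end

/-! ### Equidistribution of periodic points -/

noncomputable section

namespace LabeledGraph

variable {V E S : Type*} [Fintype V] [DecidableEq V]

theorem sum_wordAdj_finZero (G : LabeledGraph V E S) (w : Fin 0 → S) (u v : V → ℝ) :
    ∑ i, ∑ j, u i * G.wordAdj w i j * v j = ∑ i, u i * v i :=
  Finset.sum_congr rfl fun i _ => by simp [wordAdj, Matrix.one_apply]

variable [Nonempty V] [Fintype S]

/-- The trace is the sum of `G.wordAdj w i j * (G.adj ^ (N - n)) j i`. Where the first factor is
nonzero, `n` steps lead from `i` to `j`, so divisibility of `N` is exactly what the convergence of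
the second factor requires. -/
theorem tendsto_trace_wordAdj_mul_pow_div {G : LabeledGraph V E S} (hirr : G.adj.IsIrreducible)
    {r : ℝ} {u v : V → ℝ} (hr : 0 < r) (hu : ∀ i, 0 < u i) (hv : ∀ i, 0 < v i)
    (hAu : Matrix.vecMul u G.adj = r • u) (hAv : G.adj.mulVec v = r • v)
    (huv : ∑ i, u i * v i = 1) {n : ℕ} (w : Fin n → S) :
    Tendsto (fun N => (G.wordAdj w * G.adj ^ (N - n)).trace / r ^ N)
      (atTop ⊓ 𝓟 {N : ℕ | matrixPeriod G.adj ∣ N})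
      (𝓝 (matrixPeriod G.adj * ((1 / r ^ n) * ∑ i, ∑ j, u i * G.wordAdj w i j * v j))) := by
  have hle : ∀ i j, G.wordAdj w i j ≤ (G.adj ^ n) i j := by
    intro i j
    rw [← sum_wordAdj, Matrix.sum_apply]
    exact Finset.single_le_sum (f := fun w : Fin n → S => G.wordAdj w i j)
      (fun w _ => G.wordAdj_nonneg w i j) (Finset.mem_univ w)
  have hterm : ∀ i j, Tendsto (fun m => G.wordAdj w i j * ((G.adj ^ m) j i / r ^ m))
      (atTop ⊓ 𝓟 {m : ℕ | matrixPeriod G.adj ∣ n + m})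
      (𝓝 (G.wordAdj w i j * (matrixPeriod G.adj * (v j * u i)))) := by
    intro i j
    rcases (G.wordAdj_nonneg w i j).eq_or_lt with h0 | h0
    · simpa [← h0] using tendsto_const_nhds
    · exact (hirr.tendsto_pow_div hr hu hv hAu hAv huv (h0.trans_le (hle i j))).const_mul _
  have hsub : Tendsto (fun N => N - n) (atTop ⊓ 𝓟 {N : ℕ | matrixPeriod G.adj ∣ N})
      (atTop ⊓ 𝓟 {m : ℕ | matrixPeriod G.adj ∣ n + m}) := by
    refine tendsto_inf.2 ⟨(tendsto_sub_atTop_nat n).mono_left inf_le_left, tendsto_principal.2 ?_⟩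
    filter_upwards [mem_inf_of_left (Ici_mem_atTop n), mem_inf_of_right (mem_principal_self _)]
      with N hN hdvd
    rw [Nat.add_sub_of_le hN]
    exact hdvd
  have hsum := ((tendsto_finsetSum Finset.univ fun i _ =>
    tendsto_finsetSum Finset.univ fun j _ => hterm i j).comp hsub).const_mul (1 / r ^ n)
  refine (hsum.congr' ?_).trans (le_of_eq ?_)
  · filter_upwards [mem_inf_of_left (Ici_mem_atTop n)] with N hN
    obtain ⟨m, rfl⟩ := Nat.exists_eq_add_of_le hN
    simp only [Function.comp, Nat.add_sub_cancel_left, Matrix.trace, Matrix.diag_apply,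
      Matrix.mul_apply, Finset.mul_sum, Finset.sum_div]
    refine Finset.sum_congr rfl fun i _ => Finset.sum_congr rfl fun j _ => ?_
    rw [pow_add]
    field_simp
  · simp only [Finset.mul_sum]
    congr 1
    refine Finset.sum_congr rfl fun i _ => Finset.sum_congr rfl fun j _ => ?_
    ring

variable [Finite E]

theorem tendsto_ncard_periodicCylinder_div {G : LabeledGraph V E S} (hirr : G.adj.IsIrreducible)
    (hmin : G.IsMinimalRightResolving) {r : ℝ} {u v : V → ℝ} (hr : 0 < r) (hu : ∀ i, 0 < u i)
    (hv : ∀ i, 0 < v i) (hAu : Matrix.vecMul u G.adj = r • u) (hAv : G.adj.mulVec v = r • v)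
    (huv : ∑ i, u i * v i = 1) (α : ℤ) {n : ℕ} (w : Fin n → S) :
    Tendsto (fun N => ((periodicCylinder G.soficShift N α w).ncard : ℝ) / r ^ N)
      (atTop ⊓ 𝓟 {N : ℕ | matrixPeriod G.adj ∣ N})
      (𝓝 (matrixPeriod G.adj * ((1 / r ^ n) * ∑ i, ∑ j, u i * G.wordAdj w i j * v j))) := by
  obtain ⟨l, hl, hsync⟩ := hmin.1.exists_synchronizing_word (hmin.follower_injective hirr)
  have herr := (tendsto_sum_avoidingAdj_div hirr hl hr hv hAv).mono_left
    (inf_le_left (b := 𝓟 {N : ℕ | matrixPeriod G.adj ∣ N}))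
  have hdiff : Tendsto (fun N => ((periodicCylinder G.soficShift N α w).ncard : ℝ) / r ^ N -
      (G.wordAdj w * G.adj ^ (N - n)).trace / r ^ N)
      (atTop ⊓ 𝓟 {N : ℕ | matrixPeriod G.adj ∣ N}) (𝓝 0) := by
    refine squeeze_zero_norm' ?_ herr
    filter_upwards [mem_inf_of_left (Ici_mem_atTop (n + 1))] with N hN
    obtain ⟨m, rfl⟩ := Nat.exists_eq_add_of_le (Nat.le_of_succ_le hN)
    have : NeZero (n + m) := ⟨by have : n + 1 ≤ n + m := hN; omega⟩
    rw [← sub_div, norm_div, Real.norm_of_nonneg (pow_pos hr _).le, Nat.add_sub_cancel_left,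
      G.ncard_periodicCylinder_eq _ α 0]
    exact div_le_div_of_nonneg_right (abs_ncard_periodicCylinder_sub_trace_le hmin.1 hsync w)
      (pow_pos hr _).le
  have := hdiff.add (tendsto_trace_wordAdj_mul_pow_div hirr hr hu hv hAu hAv huv w)
  simpa using this

/-- Periodic points equidistribute with respect to the natural measure. -/
theorem tendsto_ncard_periodicCylinder_ratio {G : LabeledGraph V E S}
    (hirr : G.adj.IsIrreducible) (hmin : G.IsMinimalRightResolving) {r : ℝ} {u v : V → ℝ}
    (hr : 0 < r) (hu : ∀ i, 0 < u i) (hv : ∀ i, 0 < v i)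
    (hAu : Matrix.vecMul u G.adj = r • u) (hAv : G.adj.mulVec v = r • v)
    (huv : ∑ i, u i * v i = 1) (α : ℤ) {n : ℕ} (w : Fin n → S) :
    Tendsto (fun N => ((periodicCylinder G.soficShift N α w).ncard : ℝ) /
        (periodicPoints G.soficShift N).ncard)
      (atTop ⊓ 𝓟 {N : ℕ | matrixPeriod G.adj ∣ N})
      (𝓝 ((1 / r ^ n) * ∑ i, ∑ j, u i * G.wordAdj w i j * v j)) := by
  have hp : (matrixPeriod G.adj : ℝ) ≠ 0 := Nat.cast_ne_zero.2 hirr.matrixPeriod_pos.ne'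
  have h1 := tendsto_ncard_periodicCylinder_div hirr hmin hr hu hv hAu hAv huv α w
  -- The empty word counts all periodic points: its limit is the period, by the normalization of `u`
  -- and `v`.
  have h2 := tendsto_ncard_periodicCylinder_div hirr hmin hr hu hv hAu hAv huv α
    (Fin.elim0 : Fin 0 → S)
  rw [G.sum_wordAdj_finZero, huv, pow_zero, div_one, mul_one, mul_one] at h2
  simp only [periodicCylinder_finZero] at h2
  have h4 := h1.div h2 hp
  rw [mul_div_cancel_left₀ _ hp] at h4
  refine h4.congr fun N => ?_
  exact div_div_div_cancel_right₀ (pow_pos hr N).ne' _ _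

theorem tendsto_periodicRatio [MeasurableSpace S] {G : LabeledGraph V E S}
    (hirr : G.adj.IsIrreducible)
    (hmin : G.IsMinimalRightResolving) {r : ℝ} {u v : V → ℝ} (hr : 0 < r) (hu : ∀ i, 0 < u i)
    (hv : ∀ i, 0 < v i) (hAu : Matrix.vecMul u G.adj = r • u) (hAv : G.adj.mulVec v = r • v)
    (huv : ∑ i, u i * v i = 1) {n : ℕ} (hn : 0 < n) (w : Fin n → S) :
    Tendsto (fun q : ℕ × ℕ => G.periodicRatio w q.1 q.2)
      ((atTop ×ˢ atTop) ⊓ 𝓟 {q : ℕ × ℕ | matrixPeriod G.adj ∣ n + q.1 + q.2 - 1})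
      (𝓝 ((1 / r ^ n) * ∑ i, ∑ j, u i * G.wordAdj w i j * v j)) := by
  have hp : (matrixPeriod G.adj : ℝ) ≠ 0 := Nat.cast_ne_zero.2 hirr.matrixPeriod_pos.ne'
  have hN : Tendsto (fun q : ℕ × ℕ => n + q.1 + q.2 - 1)
      ((atTop ×ˢ atTop) ⊓ 𝓟 {q : ℕ × ℕ | matrixPeriod G.adj ∣ n + q.1 + q.2 - 1})
      (atTop ⊓ 𝓟 {N : ℕ | matrixPeriod G.adj ∣ N}) := by
    refine tendsto_inf.2 ⟨Tendsto.mono_left ?_ inf_le_left,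
      tendsto_principal.2 (mem_inf_of_right (mem_principal_self _))⟩
    exact tendsto_atTop_mono (fun q : ℕ × ℕ => show q.1 ≤ n + q.1 + q.2 - 1 by omega) tendsto_fst
  refine ((tendsto_ncard_periodicCylinder_ratio hirr hmin hr hu hv hAu hAv huv 1 w).comp
    hN).congr' ?_
  -- From here on `q.1 - j` is a genuine, positive difference for every `j` below the period.
  have hk : ∀ᶠ q : ℕ × ℕ in (atTop ×ˢ atTop) ⊓
      𝓟 {q : ℕ × ℕ | matrixPeriod G.adj ∣ n + q.1 + q.2 - 1}, matrixPeriod G.adj ≤ q.1 :=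
    (tendsto_fst.mono_left inf_le_left).eventually (eventually_ge_atTop _)
  filter_upwards [hk] with q hq
  have hcount : ∀ j ∈ Finset.range (matrixPeriod G.adj),
      ((periodicFiniteCylinder G.soficShift (q.1 - j) (q.2 + j) w).ncard : ℝ) =
        (periodicCylinder G.soficShift (n + q.1 + q.2 - 1) 1 w).ncard := by
    intro j hj
    have hj := Finset.mem_range.1 hj
    rw [ncard_periodicFiniteCylinder _ hn (by omega),
      show n + (q.1 - j) + (q.2 + j) - 1 = n + q.1 + q.2 - 1 by omega]
  rw [periodicRatio, Finset.sum_congr rfl hcount, Finset.sum_const, Finset.card_range,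
    nsmul_eq_mul, Function.comp]
  field_simp

end LabeledGraph
end

/-! ### Measures determined by, and constructed from, cylinder masses -/

noncomputable section

/-- Probability measures on a subset of the full shift are determined by cylinders. -/
theorem measure_eq_of_cylinderAt {S : Type*} [Finite S] [MeasurableSpace S]
    [DiscreteMeasurableSpace S] {X : Set (ℤ → S)} {μ ν : Measure X} [IsProbabilityMeasure μ]
    [IsProbabilityMeasure ν]
    (h : ∀ (α : ℤ) (n : ℕ) (w : Fin n → S), 0 < n →
      μ.real (cylinderAt X α w) = ν.real (cylinderAt X α w)) : μ = ν := by
  let win : ∀ n : ℕ, X → Fin (2 * n + 1) → S := fun n x i => x.1 (-n + i)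
  have hwin : ∀ n, Measurable (win n) := fun n =>
    measurable_pi_lambda _ fun i => (measurable_pi_apply _).comp measurable_subtype_coe
  -- Events depending on a centered window form a π-system: two of them can be read in the larger
  -- window.
  let C : Set (Set X) := {B | ∃ n, ∃ D : Set (Fin (2 * n + 1) → S), win n ⁻¹' D = B}
  have hmono : ∀ {n m : ℕ} (D : Set (Fin (2 * n + 1) → S)), n ≤ m →
      ∃ D' : Set (Fin (2 * m + 1) → S), win m ⁻¹' D' = win n ⁻¹' D := by
    intro n m D hnm
    refine ⟨(fun y (i : Fin (2 * n + 1)) => y ⟨i + (m - n), by have := i.isLt; omega⟩) ⁻¹' D, ?_⟩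
    rw [← Set.preimage_comp]
    congr 1
    funext x i
    refine congrArg x.1 ?_
    push_cast [hnm]
    ring
  refine ext_of_generate_finite C (le_antisymm ?_ ?_) ?_ ?_ (by simp)
  · have hval : @Measurable X (ℤ → S) (MeasurableSpace.generateFrom C) _ Subtype.val := by
      refine @measurable_pi_lambda _ _ _ (MeasurableSpace.generateFrom C) _ _ fun z D _ => ?_
      refine MeasurableSpace.measurableSet_generateFrom ⟨z.natAbs,
        {y | y ⟨(z + z.natAbs).toNat, by omega⟩ ∈ D}, ?_⟩
      ext x
      simp only [win, Set.mem_preimage, Set.mem_ofPred_eq]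
      rw [show -(z.natAbs : ℤ) + ((z + z.natAbs).toNat : ℕ) = z by omega]
    exact hval.comap_le
  · refine MeasurableSpace.generateFrom_le ?_
    rintro _ ⟨n, D, rfl⟩
    exact hwin n (Set.toFinite D).measurableSet
  · rintro _ ⟨n, D, rfl⟩ _ ⟨m, D', rfl⟩ -
    obtain ⟨F, hF⟩ := hmono D (le_max_left n m)
    obtain ⟨F', hF'⟩ := hmono D' (le_max_right n m)
    exact ⟨max n m, F ∩ F', by rw [Set.preimage_inter, hF, hF']⟩
  · rintro _ ⟨n, D, rfl⟩
    have hmap : μ.map (win n) = ν.map (win n) := by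
      refine Measure.ext_of_singleton fun w => ?_
      rw [Measure.map_apply (hwin n) (measurableSet_singleton w),
        Measure.map_apply (hwin n) (measurableSet_singleton w)]
      have hcyl : win n ⁻¹' {w} = cylinderAt X (-n) w := by
        ext x
        simp [win, cylinderAt, funext_iff]
      rw [hcyl]
      exact (measureReal_eq_measureReal_iff).1 (h _ _ w (by omega))
    rw [← Measure.map_apply (hwin n) (Set.toFinite D).measurableSet, hmap,
      Measure.map_apply (hwin n) (Set.toFinite D).measurableSet]

theorem isClopen_cylinderAt {S : Type*} [TopologicalSpace S] [DiscreteTopology S]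
    (X : Set (ℤ → S)) (α : ℤ) {n : ℕ} (w : Fin n → S) : IsClopen (cylinderAt X α w) := by
  have : cylinderAt X α w = (fun (x : X) (i : Fin n) => x.1 (α + i)) ⁻¹' {w} := by
    ext x
    simp [cylinderAt, funext_iff]
  rw [this]
  exact (isClopen_discrete {w}).preimage
    (continuous_pi fun i => (continuous_apply _).comp continuous_subtype_val)

theorem uniformOn_real_cylinderAt {S : Type*} [Finite S] [MeasurableSpace S]
    [DiscreteMeasurableSpace S] (X : Set (ℤ → S)) (N : ℕ) [NeZero N] (α : ℤ) {n : ℕ}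
    (w : Fin n → S) :
    (ProbabilityTheory.uniformOn {x : X | x.1 ∈ periodicPoints X N}).real (cylinderAt X α w) =
      ((periodicCylinder X N α w).ncard : ℝ) / (periodicPoints X N).ncard := by
  have hfin : {x : X | x.1 ∈ periodicPoints X N}.Finite :=
    (periodicPoints_finite X N).preimage Subtype.val_injective.injOn
  have h1 : Subtype.val '' {x : X | x.1 ∈ periodicPoints X N} = periodicPoints X N := by
    ext x
    simp only [Set.mem_image, Set.mem_ofPred_eq, Subtype.exists, exists_and_left, exists_prop,
      exists_eq_right_right, and_iff_left_iff_imp]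
    exact fun hx => hx.1
  have h2 : Subtype.val '' ({x : X | x.1 ∈ periodicPoints X N} ∩ cylinderAt X α w) =
      periodicCylinder X N α w := by
    ext x
    simp only [periodicCylinder, cylinderAt, Set.mem_image, Set.mem_inter_iff, Set.mem_ofPred_eq]
    constructor
    · rintro ⟨x, hx, rfl⟩
      exact hx
    · exact fun hx => ⟨⟨x, hx.1.1⟩, hx, rfl⟩
  have h3 := congrArg Set.ncard h1
  have h4 := congrArg Set.ncard h2
  rw [Set.ncard_image_of_injective _ Subtype.val_injective] at h3 h4
  rw [← h3, ← h4, Measure.real, ProbabilityTheory.uniformOn,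
    ProbabilityTheory.cond_apply hfin.measurableSet, Measure.count_apply_finite _ hfin,
    Measure.count_apply_finite _ (hfin.inter_of_left _), Set.ncard_eq_toFinset_card _ hfin,
    Set.ncard_eq_toFinset_card _ (hfin.inter_of_left _)]
  simp [div_eq_inv_mul]

/-- A measure with the given limits of periodic-point frequencies on cylinders, as a cluster point
of the uniform measures on periodic points. -/
theorem LabeledGraph.exists_measure_of_tendsto {V E S : Type*} [Finite E] [Finite S]
    [MeasurableSpace S] [DiscreteMeasurableSpace S] (G : LabeledGraph V E S) {F : Filter ℕ}
    [F.NeBot] (hF : F ≤ atTop) (hne : ∀ᶠ N in F, (periodicPoints G.soficShift N).Nonempty)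
    {m : ∀ n : ℕ, (Fin n → S) → ℝ}
    (hm : ∀ (α : ℤ) (n : ℕ) (w : Fin n → S), Tendsto (fun N =>
      ((periodicCylinder G.soficShift N α w).ncard : ℝ) / (periodicPoints G.soficShift N).ncard)
        F (𝓝 (m n w))) :
    ∃ μ : Measure G.soficShift, IsProbabilityMeasure μ ∧
      ∀ (α : ℤ) (n : ℕ) (w : Fin n → S), μ.real (cylinderAt G.soficShift α w) = m n w := by
  classical
  let : TopologicalSpace S := ⊥
  have : DiscreteTopology S := ⟨rfl⟩
  have : CompactSpace G.soficShift := isCompact_iff_compactSpace.1 G.isCompact_soficShift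
  obtain ⟨N₀, x₀, hx₀⟩ := hne.exists
  -- The Dirac measure is a mere default, never taken eventually along `F`.
  let U : ℕ → ProbabilityMeasure G.soficShift := fun N =>
    if h : IsProbabilityMeasure (ProbabilityTheory.uniformOn
      {x : G.soficShift | x.1 ∈ periodicPoints G.soficShift N})
    then ⟨_, h⟩ else ⟨Measure.dirac ⟨x₀, hx₀.1⟩, inferInstance⟩
  have hU : ∀ᶠ N in F, ∀ (α : ℤ) (n : ℕ) (w : Fin n → S),
      (U N : Measure G.soficShift).real (cylinderAt G.soficShift α w) =
        ((periodicCylinder G.soficShift N α w).ncard : ℝ) /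
          (periodicPoints G.soficShift N).ncard := by
    filter_upwards [hne, hF (Ici_mem_atTop 1)] with N hN hN1 α n w
    have : NeZero N := ⟨by have : 1 ≤ N := hN1; omega⟩
    have hprob : IsProbabilityMeasure (ProbabilityTheory.uniformOn
        {x : G.soficShift | x.1 ∈ periodicPoints G.soficShift N}) := by
      obtain ⟨x, hx⟩ := hN
      exact ProbabilityTheory.isProbabilityMeasure_uniformOn
        ((periodicPoints_finite _ N).preimage Subtype.val_injective.injOn) ⟨⟨x, hx.1⟩, hx⟩
    rw [show U N = ⟨_, hprob⟩ from dif_pos hprob]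
    exact uniformOn_real_cylinderAt _ N α w
  obtain ⟨μ, hμ⟩ := exists_clusterPt_of_compactSpace (F.map U)
  -- An ultrafilter finer than `F` along which `U` converges; cylinder masses already converge along
  -- `F`, so they keep their limits.
  obtain ⟨W, hWF, hW⟩ := mapClusterPt_iff_ultrafilter.1 hμ
  refine ⟨μ, inferInstance, fun α n w => ?_⟩
  have h1 := ProbabilityMeasure.tendsto_measure_of_isClopen_of_tendsto hW
    (isClopen_cylinderAt G.soficShift α w)
  have h2 : Tendsto (fun N => (U N : Measure G.soficShift).real (cylinderAt G.soficShift α w)) W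
      (𝓝 ((μ : Measure G.soficShift).real (cylinderAt G.soficShift α w))) :=
    (NNReal.tendsto_coe.2 h1)
  have h3 : Tendsto (fun N => (U N : Measure G.soficShift).real (cylinderAt G.soficShift α w)) W
      (𝓝 (m n w)) := by
    refine ((hm α n w).mono_left hWF).congr' ?_
    filter_upwards [hWF hU] with N hN
    exact (hN α n w).symm
  exact tendsto_nhds_unique h2 h3

end

theorem mainTheorem10 {V E S : Type*} [Fintype V] [DecidableEq V] [Nonempty V] [Fintype E]
    [Fintype S] [MeasurableSpace S] [DiscreteMeasurableSpace S]
    (G : LabeledGraph V E S) (hirr : G.adj.IsIrreducible) (hmin : G.IsMinimalRightResolving) :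
    ∃ μ : Measure G.soficShift,
      (G.IsNaturalMeasure μ ∧ ∀ ν : Measure G.soficShift, G.IsNaturalMeasure ν → ν = μ) ∧
      (G.IsPeriodicNaturalMeasure μ ∧
        ∀ ν : Measure G.soficShift, G.IsPeriodicNaturalMeasure ν → ν = μ) := by
  have hp := hirr.matrixPeriod_pos
  have hbot : (atTop ⊓ 𝓟 {N : ℕ | matrixPeriod G.adj ∣ N}).NeBot := by
    rw [← frequently_mem_iff_neBot, frequently_atTop]
    exact fun a => ⟨matrixPeriod G.adj * a, Nat.le_mul_of_pos_left a hp, dvd_mul_right _ _⟩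
  have hbot' : ∀ n : ℕ, ((atTop ×ˢ atTop) ⊓
      𝓟 {q : ℕ × ℕ | matrixPeriod G.adj ∣ n + q.1 + q.2 - 1}).NeBot := by
    intro n
    rw [prod_atTop_atTop_eq, ← frequently_mem_iff_neBot, frequently_atTop]
    rintro ⟨a, b⟩
    -- Chosen so that `n + k + l - 1` is the period times `a + b + n + 1`, large enough for `k ≥ a`.
    refine ⟨(matrixPeriod G.adj * (a + b + n + 1) + 1 - n - b, b), ⟨?_, le_rfl⟩, ?_⟩
    all_goals have := Nat.le_mul_of_pos_left (a + b + n + 1) hp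
    · show a ≤ _
      omega
    · rw [Set.mem_ofPred_eq, show n + (matrixPeriod G.adj * (a + b + n + 1) + 1 - n - b) + b - 1 =
        matrixPeriod G.adj * (a + b + n + 1) by omega]
      exact dvd_mul_right _ _
  obtain ⟨r, u, v, hperron, hu, hv, hAu, hAv, huv⟩ := hirr.exists_perron_data
  have hr := hirr.eigenvalue_pos hperron.1 hv hAv
  have hne : ∀ᶠ N in atTop ⊓ 𝓟 {N : ℕ | matrixPeriod G.adj ∣ N},
      (periodicPoints G.soficShift N).Nonempty := by
    -- For the empty word the ratio tends to `1`, whereas with no periodic points it would be `0 / 0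
    -- = 0`.
    have h1 := LabeledGraph.tendsto_ncard_periodicCylinder_ratio hirr hmin hr hu hv hAu hAv huv 0
      (Fin.elim0 : Fin 0 → S)
    have h2 : (0 : ℝ) < (1 / r ^ 0) *
        ∑ i, ∑ j, u i * G.wordAdj (Fin.elim0 : Fin 0 → S) i j * v j := by
      simp [G.sum_wordAdj_finZero, huv]
    filter_upwards [h1.eventually (lt_mem_nhds h2)] with N hN
    by_contra h0
    rw [Set.not_nonempty_iff_eq_empty] at h0
    simp [h0] at hN
  obtain ⟨μ, hμ, hμc⟩ := G.exists_measure_of_tendsto inf_le_left hne fun α n w =>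
    LabeledGraph.tendsto_ncard_periodicCylinder_ratio hirr hmin hr hu hv hAu hAv huv α w
  refine ⟨μ, ⟨⟨hμ, r, u, v, hperron, hu, hv, hAu, hAv, huv, fun α n w _ => hμc α n w⟩, ?_⟩,
    ⟨hμ, fun α n w hn => ?_⟩, ?_⟩
  · rintro ν ⟨hν, r', u', v', hperron', hu', hv', hAu', hAv', huv', hνc⟩
    -- Other Perron data give the same cylinder masses, both being limits of the same frequencies of
    -- periodic points.
    have hr' := hirr.eigenvalue_pos hperron'.1 hv' hAv'
    refine measure_eq_of_cylinderAt fun α n w hn => ?_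
    rw [hμc α n w, hνc α n w hn]
    exact tendsto_nhds_unique
      (LabeledGraph.tendsto_ncard_periodicCylinder_ratio hirr hmin hr' hu' hv' hAu' hAv' huv' 0 w)
      (LabeledGraph.tendsto_ncard_periodicCylinder_ratio hirr hmin hr hu hv hAu hAv huv 0 w)
  · rw [hμc α n w]
    exact LabeledGraph.tendsto_periodicRatio hirr hmin hr hu hv hAu hAv huv hn w
  · rintro ν ⟨hν, hνc⟩
    refine measure_eq_of_cylinderAt fun α n w hn => ?_
    have := hbot' n
    rw [hμc α n w]
    exact tendsto_nhds_unique (hνc α n w hn)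
      (LabeledGraph.tendsto_periodicRatio hirr hmin hr hu hv hAu hAv huv hn w)
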